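/- **Setting.** Transfer function matrices are matrices of rational functions of $s$; "proper" and "real rational" have their usual meaning, $\mathcal{RH}_\infty$ is the set of proper, real rational matrices with all poles in the open left half-plane, and $\|G\|_\infty=\sup_{\omega\in\mathbb R}\|G(i\omega)\|$ (spectral norm) for $G\in\mathcal{RH}_\infty$. A square $G$ is *bistable and biproper* if $G,G^{-1}\in\mathcal{RH}_\infty$. For $P=\begin{bmatrix}P_{11}&P_{12}\\P_{21}&P_{22}\end{bmatrix}$ and $K$, put $\mathcal F_l(P,K)=P_{11}+P_{12}K(I-P_{22}K)^{-1}P_{21}$; it is *well-posed* if $I-P_{22}K$ has a proper real rational inverse, and *internally stable* if all closed-loop transfer matrices from $(w,d_1,d_2)$ to $(u,y,z)$ in $z=P_{11}w+P_{12}y$, $u=P_{21}w+P_{22}y+d_1$, $y=Ku+d_2$ are in $\mathcal{RH}_\infty$. Let $\Sigma^1,\dots,\Sigma^k$ ($\Sigma^j$ of size $p_j\times m_j$), $\Sigma_B=\operatorname{diag}(\Sigma^1,\dots,\Sigma^k)$, and $S=\begin{bmatrix}S_{11}&S_{12}\\S_{21}&S_{22}\end{bmatrix}$ with inputs $(w,y^1,\dots,y^k)$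 and outputs $(z,u^1,\dots,u^k)$, $\dim w=m_C$, $\dim z=p_C$. Let $S^{(j)}$ be $S$ with rows and columns permuted to outputs $(z,u^j\,|\,u^l,\,l\ne j)$ and inputs $(w,y^j\,|\,y^l,\,l\neq j)$, write $S_{22}^{j,j},S_{22}^{j,l},S_{22}^{l,j},S_{22}^{l,l}$ for the corresponding parts of $S_{22}$ ($l$ standing for all indices other than $j$), let $\Sigma_B^{(j)}=\operatorname{diag}(\Sigma^l)_{l\ne j}$ and let $E^j=\mathcal F_l(S^{(j)},\Sigma_B^{(j)})$ be the environment of $\Sigma^j$. Assume $\Sigma^j,S\in\mathcal{RH}_\infty$ and that $\mathcal F_l(S,\Sigma_B)$ and all $\mathcal F_l(S^{(j)},\Sigma_B^{(j)})$ are well-posed and internally stable. **Errors.** Let $\hat\Sigma^j$ (reduced subsystems) be proper real rational, $\hat\Sigma_B=\operatorname{diag}(\hat\Sigma^1,\dots,\hat\Sigma^k)$ and $E_C=\mathcal F_l(S,\hat\Sigma_B)-\mathcal F_l(S,\Sigma_B)$. *Environment abstraction:* $\hat E^j$ are proper real rational abstractions of $E^j$, with abstraction errors $\Delta_A^j=(\hat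 E^j-E^j)_{22}$. *Subsystem abstraction:* $\tilde\Sigma^j$ are proper real rational abstractions of $\Sigma^j$, with abstraction errors $\Delta_A^j=\tilde\Sigma^j-\Sigma^j$, and $\hat E^j=\mathcal F_l(S^{(j)},\operatorname{diag}(\tilde\Sigma^l)_{l\neq j})$, assumed well-posed. In both cases, let $G_u^j,G_y^j$ be nonsingular constant complex matrices, let $$\hat F^j=\left[\begin{array}{cc|c}\hat E^j_{11}&0&\hat E^j_{12}\\0&0&G^j_y\\\hline \hat E^j_{21}&G_u^j&\hat E^j_{22}\end{array}\right],$$ assume $\mathcal F_l(\hat F^j,\Sigma^j)$ and $\mathcal F_l(\hat F^j,\hat\Sigma^j)$ are well-posed, and put $\tilde E_F^j=(G^j_y)^{-1}\big(\mathcal F_l(\hat F^j,\hat\Sigma^j)-\mathcal F_l(\hat F^j,\Sigma^j)\big)_{22}(G_u^j)^{-1}$. Assume $\Delta_A^j,\tilde E_F^j\in\mathcal{RH}_\infty$ for all $j$. **The system $N$.** Let $M=(I-\Sigma_BS_{22})^{-1}\Sigma_B$ and $Z=S_{22}-\operatorname{diag}(E^1_{22},\dots,E^k_{22})$. For environment abstraction,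 $$N=\left[\begin{array}{ccc|c}-M&I+MZ&M&MS_{21}\\-ZM-I&Z(I+MZ)&ZM&(I+ZM)S_{21}\\-M&MZ&M&MS_{21}\\\hline-S_{12}M&S_{12}(I+MZ)&S_{12}M&0\end{array}\right].$$ For subsystem abstraction, let $L^j=(I-S_{22}^{l,l}\Sigma_B^{(j)})^{-1}$, $\bar E^j_{11}=S_{22}^{j,j}+S_{22}^{j,l}\Sigma_B^{(j)}L^jS_{22}^{l,j}$, $\bar E^j_{12}=S_{22}^{j,l}(I+\Sigma_B^{(j)}L^jS_{22}^{l,l})$, $\bar E^j_{21}=L^jS_{22}^{l,j}$, $\bar E^j_{22}=L^jS_{22}^{l,l}$, $\bar E_{ab}=\operatorname{diag}(\bar E_{ab}^1,\dots,\bar E_{ab}^k)$, $Y=S_{22}-\bar E_{11}$, and $$N=\left[\begin{array}{ccc|c}\bar E_{22}-\bar E_{21}M\bar E_{12}&\bar E_{21}(I+MY)&\bar E_{21}M\bar E_{12}&\bar E_{21}MS_{21}\\-YM\bar E_{12}-\bar E_{12}&Y(I+MY)&YM\bar E_{12}&(I+YM)S_{21}\\-\bar E_{21}M\bar E_{12}&\bar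 E_{21}MY&\bar E_{22}+\bar E_{21}M\bar E_{12}&\bar E_{21}MS_{21}\\\hline-S_{12}M\bar E_{12}&S_{12}(I+MY)&S_{12}M\bar E_{12}&0\end{array}\right].$$ **Weights.** Let $V_A^j,W_A^j,V_F^j,W_F^j,V_C,W_C$ be square weights of matching sizes. For environment abstraction $V=\operatorname{diag}(V_A^1,\dots,V_A^k,V_F^1,\dots,V_F^k,V_A^1,\dots,V_A^k,V_C)$; for subsystem abstraction each $V_A^j$ herein is replaced by $\operatorname{diag}(V_A^l)_{l\ne j}$; $W$ is formed in the same way. Assume $V$ and $W$ are bistable and biproper, and let $\mathcal N=VNW$. **Scalings.** The channels of $N$ are grouped by the low-level error that acts on them: in environment abstraction $\Delta_A^j$ occurs $r=2$ times, in subsystem abstraction $r=2(k-1)$ times; $\tilde E_F^j$ occurs once. Up to the corresponding permutations of rows and columns, $\mathbb D$ is the set of pairs $(D_\ell,D_r)$ with $$D_\ell=\operatorname{diag}\big(Q^1\otimes I_{a_1},\dots,Q^k\otimes I_{a_k},d^1I_{m_1},\dots,d^kI_{m_k},I_{p_C}\big),\quad D_r=\operatorname{diag}\big(Q^1\otimes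 I_{b_1},\dots,Q^k\otimes I_{b_k},d^1I_{p_1},\dots,d^kI_{p_k},I_{m_C}\big),$$ where $Q^j\in\mathbb C^{r\times r}$ is Hermitian positive definite, $d^j>0$, and $(a_j,b_j)=(p_j,m_j)$ for environment abstraction, $(a_j,b_j)=(m_j,p_j)$ for subsystem abstraction. **Theorem.** In either of the two cases, suppose that some $(D_\ell,D_r)\in\mathbb D$ satisfies $$\mathcal N(i\omega)D_r\mathcal N(i\omega)^H\preceq D_\ell\qquad\text{for all }\omega\in\mathbb R,$$ and that for all $j$ $$\|(W_A^j)^{-1}\Delta_A^j(V_A^j)^{-1}\|_\infty\le1,\qquad\|(W_F^j)^{-1}\tilde E_F^j(V_F^j)^{-1}\|_\infty\le1.$$ Suppose moreover that these two requirements are not both tight: either $\mathcal N(i\omega)D_r\mathcal N(i\omega)^H\preceq\eta D_\ell$ for all $\omega\in\mathbb R$ with some $\eta<1$, or all the norms in the second display are $<1$. Then $\mathcal F_l(S,\hat\Sigma_B)$ is well-posed and internally stable, $E_C\in\mathcal{RH}_\infty$, and $\|V_CE_CW_C\|_\infty<1$. -/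

import Mathlib

open Matrix
open scoped Kronecker ComplexOrder

noncomputable section

/-! ## Transfer function matrices

Everything lives over the field of complex rational functions; being real rational is a
separate requirement. This allows complex constant weights on otherwise real systems. -/

/-- A complex rational function is real rational if it is a quotient of real polynomials. -/
def IsRealRational (f : RatFunc ℂ) : Prop :=
  ∃ a b : Polynomial ℝ, b ≠ 0 ∧
    f = algebraMap (Polynomial ℂ) (RatFunc ℂ) (a.map Complex.ofRealHom) /
        algebraMap (Polynomial ℂ) (RatFunc ℂ) (b.map Complex.ofRealHom)

/-- Proper: bounded at infinity. -/
def IsProperFn (f : RatFunc ℂ) : Prop := f.num.natDegree ≤ f.denom.natDegree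

/-- Stable: all poles lie in the open left half-plane (`f.denom` is coprime to `f.num`). -/
def IsStableFn (f : RatFunc ℂ) : Prop := ∀ s : ℂ, f.denom.eval s = 0 → s.re < 0

/-- A proper, real rational transfer function matrix. -/
def IsTransfer {a b : Type*} (G : Matrix a b (RatFunc ℂ)) : Prop :=
  ∀ i j, IsRealRational (G i j) ∧ IsProperFn (G i j)

/-- The class `RH∞` of proper, real rational, stable transfer function matrices. -/
def InRHinf {a b : Type*} (G : Matrix a b (RatFunc ℂ)) : Prop :=
  ∀ i j, IsRealRational (G i j) ∧ IsProperFn (G i j) ∧ IsStableFn (G i j)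

/-- Bistable and biproper: `G` and its inverse both exist in `RH∞`. -/
def IsBistableBiproper {a : Type*} [Fintype a] [DecidableEq a]
    (G : Matrix a a (RatFunc ℂ)) : Prop :=
  InRHinf G ∧ IsUnit G.det ∧ InRHinf G⁻¹

/-- The value `G(iω)`. -/
def freqResp {a b : Type*} (G : Matrix a b (RatFunc ℂ)) (ω : ℝ) : Matrix a b ℂ :=
  G.map fun f => f.eval (RingHom.id ℂ) (Complex.I * ω)

open scoped Matrix.Norms.L2Operator in
/-- The spectral norm (largest singular value) of a complex matrix. -/
def matSpectralNorm {a b : Type*} [Fintype a] [Fintype b] [DecidableEq b]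
    (A : Matrix a b ℂ) : ℝ := ‖A‖

/-- The `H∞` norm (of an element of `RH∞`): the supremum over all frequencies of the spectral
norm of the frequency response, as an extended nonnegative number. -/
def hinfNorm {a b : Type*} [Fintype a] [Fintype b] [DecidableEq b]
    (G : Matrix a b (RatFunc ℂ)) : ENNReal :=
  ⨆ ω : ℝ, ENNReal.ofReal (matSpectralNorm (freqResp G ω))

/-! ## Linear fractional transformations -/

section LFT

variable {z u w y : Type*} [Fintype u] [DecidableEq u] [Fintype y] [DecidableEq y]

/-- The lower linear fractional transformation. -/
def lowerLFT (P : Matrix (z ⊕ u) (w ⊕ y) (RatFunc ℂ)) (K : Matrix y u (RatFunc ℂ)) :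
    Matrix z w (RatFunc ℂ) :=
  P.toBlocks₁₂ * K * (1 - P.toBlocks₂₂ * K)⁻¹ * P.toBlocks₂₁ + P.toBlocks₁₁

/-- Well-posedness of the lower LFT: `I - P₂₂ K` has a proper real rational inverse. -/
def WellPosed (P : Matrix (z ⊕ u) (w ⊕ y) (RatFunc ℂ)) (K : Matrix y u (RatFunc ℂ)) : Prop :=
  IsUnit (1 - P.toBlocks₂₂ * K).det ∧ IsTransfer (1 - P.toBlocks₂₂ * K)⁻¹

/-- Internal stability of the lower LFT. In the loop `z = P₁₁ w + P₁₂ y`,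
`u = P₂₁ w + P₂₂ y + d₁`, `y = K u + d₂`, all nine closed-loop transfer function matrices from
`w, d₁, d₂` to `u, y, z` belong to `RH∞`. -/
def InternallyStable (P : Matrix (z ⊕ u) (w ⊕ y) (RatFunc ℂ)) (K : Matrix y u (RatFunc ℂ)) :
    Prop :=
  let Q := (1 - P.toBlocks₂₂ * K)⁻¹
  InRHinf (Q * P.toBlocks₂₁) ∧ InRHinf Q ∧ InRHinf (Q * P.toBlocks₂₂) ∧
  InRHinf (K * Q * P.toBlocks₂₁) ∧ InRHinf (K * Q) ∧ InRHinf (1 + K * Q * P.toBlocks₂₂) ∧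
  InRHinf (lowerLFT P K) ∧ InRHinf (P.toBlocks₁₂ * K * Q) ∧
  InRHinf (P.toBlocks₁₂ * (1 + K * Q * P.toBlocks₂₂))

end LFT

/-! ## Block matrices -/

section Blocks

variable {R : Type*} [Zero R] {a₁ a₂ a₃ b₁ b₂ b₃ : Type*}

/-- A three-by-three block matrix. -/
def block33
    (A₁₁ : Matrix a₁ b₁ R) (A₁₂ : Matrix a₁ b₂ R) (A₁₃ : Matrix a₁ b₃ R)
    (A₂₁ : Matrix a₂ b₁ R) (A₂₂ : Matrix a₂ b₂ R) (A₂₃ : Matrix a₂ b₃ R)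
    (A₃₁ : Matrix a₃ b₁ R) (A₃₂ : Matrix a₃ b₂ R) (A₃₃ : Matrix a₃ b₃ R) :
    Matrix (a₁ ⊕ (a₂ ⊕ a₃)) (b₁ ⊕ (b₂ ⊕ b₃)) R :=
  fromRows (fromCols A₁₁ (fromCols A₁₂ A₁₃))
    (fromRows (fromCols A₂₁ (fromCols A₂₂ A₂₃)) (fromCols A₃₁ (fromCols A₃₂ A₃₃)))

/-- The block-diagonal matrix `diag(A, B)`. -/
def diag2 (A : Matrix a₁ b₁ R) (B : Matrix a₂ b₂ R) : Matrix (a₁ ⊕ a₂) (b₁ ⊕ b₂) R :=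
  fromBlocks A 0 0 B

end Blocks

/-! ## The interconnected system

There are `k` subsystems; subsystem `j` has `m j` inputs and `p j` outputs. -/

/-- Index set of a stacked signal `(u¹, …, uᵏ)` with `uʲ` of dimension `n j`. -/
abbrev Stack {k : ℕ} (n : Fin k → ℕ) : Type := Σ j : Fin k, Fin (n j)

/-- Index set of the stacked signal with the `j`-th part left out. -/
abbrev StackBut {k : ℕ} (n : Fin k → ℕ) (j : Fin k) : Type := Σ l : {l : Fin k // l ≠ j}, Fin (n l)

section Interconnection

variable {k : ℕ} {m p : Fin k → ℕ} {mC pC : ℕ}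

/-- Parallel connection `Σ_B = diag(Σ¹, …, Σᵏ)` of a family of blocks. -/
def par {r c : Fin k → ℕ} (G : ∀ j, Matrix (Fin (r j)) (Fin (c j)) (RatFunc ℂ)) :
    Matrix (Stack r) (Stack c) (RatFunc ℂ) :=
  blockDiagonal' G

/-- Parallel connection of all blocks but the `j`-th. -/
def parBut {r c : Fin k → ℕ} (G : ∀ j, Matrix (Fin (r j)) (Fin (c j)) (RatFunc ℂ)) (j : Fin k) :
    Matrix (StackBut r j) (StackBut c j) (RatFunc ℂ) :=
  blockDiagonal' fun l : {l : Fin k // l ≠ j} => G l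

/-- The reordering of signals that moves the `j`-th part to the front of the stack:
`(external, j-th part | all other parts)`. -/
def splitIdx (n : Fin k → ℕ) (c : ℕ) (j : Fin k) :
    (Fin c ⊕ Fin (n j)) ⊕ StackBut n j → Fin c ⊕ Stack n
  | Sum.inl (Sum.inl e) => Sum.inl e
  | Sum.inl (Sum.inr x) => Sum.inr ⟨j, x⟩
  | Sum.inr ⟨l, x⟩ => Sum.inr ⟨l, x⟩

/-- The interconnection dynamics with the rows and columns permuted so that the signals of
subsystem `j` become external. -/
def permS (S : Matrix (Fin pC ⊕ Stack m) (Fin mC ⊕ Stack p) (RatFunc ℂ)) (j : Fin k) :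
    Matrix ((Fin pC ⊕ Fin (m j)) ⊕ StackBut m j) ((Fin mC ⊕ Fin (p j)) ⊕ StackBut p j)
      (RatFunc ℂ) :=
  S.submatrix (splitIdx m pC j) (splitIdx p mC j)

/-- The environment of subsystem `j`, composed of `S` and all the other systems `G l`, `l ≠ j`. -/
def env (S : Matrix (Fin pC ⊕ Stack m) (Fin mC ⊕ Stack p) (RatFunc ℂ))
    (G : ∀ j, Matrix (Fin (p j)) (Fin (m j)) (RatFunc ℂ)) (j : Fin k) :
    Matrix (Fin pC ⊕ Fin (m j)) (Fin mC ⊕ Fin (p j)) (RatFunc ℂ) :=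
  lowerLFT (permS S j) (parBut G j)

/-- Standing assumption: the subsystems and the interconnection dynamics are in `RH∞`; the
interconnected system and all environments are well-posed and internally stable. -/
structure StandingAssumption
    (S : Matrix (Fin pC ⊕ Stack m) (Fin mC ⊕ Stack p) (RatFunc ℂ))
    (G : ∀ j, Matrix (Fin (p j)) (Fin (m j)) (RatFunc ℂ)) : Prop where
  sub_stable : ∀ j, InRHinf (G j)
  inter_stable : InRHinf S
  wellPosed : WellPosed S (par G)
  internallyStable : InternallyStable S (par G)
  env_wellPosed : ∀ j, WellPosed (permS S j) (parBut G j)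
  env_internallyStable : ∀ j, InternallyStable (permS S j) (parBut G j)

/-! ## Errors -/

/-- The (abstracted) environment `E`, augmented with the weighted inputs and outputs of the
subsystem it is connected to. -/
def augEnv {a b : ℕ} (E : Matrix (Fin pC ⊕ Fin a) (Fin mC ⊕ Fin b) (RatFunc ℂ))
    (Gu : Matrix (Fin a) (Fin a) ℂ) (Gy : Matrix (Fin b) (Fin b) ℂ) :
    Matrix ((Fin pC ⊕ Fin b) ⊕ Fin a) ((Fin mC ⊕ Fin a) ⊕ Fin b) (RatFunc ℂ) :=
  fromBlocks
    (fromBlocks E.toBlocks₁₁ 0 0 0)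
    (fromRows E.toBlocks₁₂ (Gy.map RatFunc.C))
    (fromCols E.toBlocks₂₁ (Gu.map RatFunc.C))
    E.toBlocks₂₂

/-- The reduction error `E_F` of one subsystem `G`, reduced to `Ghat`, in connection with the
augmented environment built from `E`. -/
def redError {a b : ℕ} (E : Matrix (Fin pC ⊕ Fin a) (Fin mC ⊕ Fin b) (RatFunc ℂ))
    (Gu : Matrix (Fin a) (Fin a) ℂ) (Gy : Matrix (Fin b) (Fin b) ℂ)
    (G Ghat : Matrix (Fin b) (Fin a) (RatFunc ℂ)) :
    Matrix (Fin pC ⊕ Fin b) (Fin mC ⊕ Fin a) (RatFunc ℂ) :=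
  lowerLFT (augEnv E Gu Gy) Ghat - lowerLFT (augEnv E Gu Gy) G

/-- The normalized reduction error `G_y⁻¹ E_{F,22} G_u⁻¹`. -/
def redErrorNorm {a b : ℕ} (E : Matrix (Fin pC ⊕ Fin a) (Fin mC ⊕ Fin b) (RatFunc ℂ))
    (Gu : Matrix (Fin a) (Fin a) ℂ) (Gy : Matrix (Fin b) (Fin b) ℂ)
    (G Ghat : Matrix (Fin b) (Fin a) (RatFunc ℂ)) : Matrix (Fin b) (Fin a) (RatFunc ℂ) :=
  (Gy.map RatFunc.C)⁻¹ * (redError E Gu Gy G Ghat).toBlocks₂₂ * (Gu.map RatFunc.C)⁻¹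

/-- The error of the reduced interconnected system. -/
def intError (S : Matrix (Fin pC ⊕ Stack m) (Fin mC ⊕ Stack p) (RatFunc ℂ))
    (G Ghat : ∀ j, Matrix (Fin (p j)) (Fin (m j)) (RatFunc ℂ)) :
    Matrix (Fin pC) (Fin mC) (RatFunc ℂ) :=
  lowerLFT S (par Ghat) - lowerLFT S (par G)

/-- The weighted low-level error `W⁻¹ Δ V⁻¹`. -/
def weightedError {a b : Type*} [Fintype a] [DecidableEq a] [Fintype b] [DecidableEq b]
    (W : Matrix a a (RatFunc ℂ)) (V : Matrix b b (RatFunc ℂ)) (Δ : Matrix a b (RatFunc ℂ)) :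
    Matrix a b (RatFunc ℂ) :=
  W⁻¹ * Δ * V⁻¹

/-- The low-level requirement `‖W⁻¹ Δ V⁻¹‖_∞ ≤ 1`. -/
def lowSpec {a b : Type*} [Fintype a] [DecidableEq a] [Fintype b] [DecidableEq b]
    (W : Matrix a a (RatFunc ℂ)) (V : Matrix b b (RatFunc ℂ)) : Set (Matrix a b (RatFunc ℂ)) :=
  {Δ | hinfNorm (weightedError W V Δ) ≤ 1}

/-- The high-level requirement: `E ∈ RH∞` and `‖V E W‖_∞ < 1`. -/
def highSpec {a b : Type*} [Fintype a] [Fintype b] [DecidableEq b]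
    (V : Matrix a a (RatFunc ℂ)) (W : Matrix b b (RatFunc ℂ)) : Set (Matrix a b (RatFunc ℂ)) :=
  {E | InRHinf E ∧ hinfNorm (V * E * W) < 1}

/-! ## The systems relating low-level errors and the interconnected error -/

/-- `M = (I - Σ_B S₂₂)⁻¹ Σ_B`. -/
def sysM (S : Matrix (Fin pC ⊕ Stack m) (Fin mC ⊕ Stack p) (RatFunc ℂ))
    (G : ∀ j, Matrix (Fin (p j)) (Fin (m j)) (RatFunc ℂ)) :
    Matrix (Stack p) (Stack m) (RatFunc ℂ) :=
  (1 - par G * S.toBlocks₂₂)⁻¹ * par G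

/-- `Z = S₂₂ - E_{B,22}` with `E_{B,22} = diag(E¹₂₂, …, Eᵏ₂₂)`. -/
def sysZ (S : Matrix (Fin pC ⊕ Stack m) (Fin mC ⊕ Stack p) (RatFunc ℂ))
    (G : ∀ j, Matrix (Fin (p j)) (Fin (m j)) (RatFunc ℂ)) :
    Matrix (Stack m) (Stack p) (RatFunc ℂ) :=
  S.toBlocks₂₂ - par fun j => (env S G j).toBlocks₂₂

/-- The system `N` for environment abstraction, with inputs `(d_A, d_F, d_C | w)` and
outputs `(v_A, v_F, v_C | z)`. -/
def sysNE (S : Matrix (Fin pC ⊕ Stack m) (Fin mC ⊕ Stack p) (RatFunc ℂ))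
    (G : ∀ j, Matrix (Fin (p j)) (Fin (m j)) (RatFunc ℂ)) :
    Matrix ((Stack p ⊕ (Stack m ⊕ Stack p)) ⊕ Fin pC)
      ((Stack m ⊕ (Stack p ⊕ Stack m)) ⊕ Fin mC) (RatFunc ℂ) :=
  let M := sysM S G
  let Z := sysZ S G
  let S12 := S.toBlocks₁₂
  let S21 := S.toBlocks₂₁
  fromBlocks
    (block33
      (-M)           (1 + M * Z)       M
      (-(Z * M) - 1) (Z * (1 + M * Z)) (Z * M)
      (-M)           (M * Z)           M)
    (fromRows (M * S21) (fromRows ((1 + Z * M) * S21) (M * S21)))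
    (fromCols (-(S12 * M)) (fromCols (S12 * (1 + M * Z)) (S12 * M)))
    0

/-- `L = (I - S₂₂^{l,l} Σ_B^{-j})⁻¹`, where `l` ranges over all indices but `j`. -/
def extL (S : Matrix (Fin pC ⊕ Stack m) (Fin mC ⊕ Stack p) (RatFunc ℂ))
    (G : ∀ j, Matrix (Fin (p j)) (Fin (m j)) (RatFunc ℂ)) (j : Fin k) :
    Matrix (StackBut m j) (StackBut m j) (RatFunc ℂ) :=
  (1 - (permS S j).toBlocks₂₂ * parBut G j)⁻¹

/-- `Ē¹¹` of the extended environment of subsystem `j`. -/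
def extEnv11 (S : Matrix (Fin pC ⊕ Stack m) (Fin mC ⊕ Stack p) (RatFunc ℂ))
    (G : ∀ j, Matrix (Fin (p j)) (Fin (m j)) (RatFunc ℂ)) (j : Fin k) :
    Matrix (Fin (m j)) (Fin (p j)) (RatFunc ℂ) :=
  (permS S j).toBlocks₁₁.toBlocks₂₂ +
    (permS S j).toBlocks₁₂.toRows₂ * parBut G j * extL S G j * (permS S j).toBlocks₂₁.toCols₂

/-- `Ē¹²` of the extended environment of subsystem `j`. -/
def extEnv12 (S : Matrix (Fin pC ⊕ Stack m) (Fin mC ⊕ Stack p) (RatFunc ℂ))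
    (G : ∀ j, Matrix (Fin (p j)) (Fin (m j)) (RatFunc ℂ)) (j : Fin k) :
    Matrix (Fin (m j)) (StackBut p j) (RatFunc ℂ) :=
  (permS S j).toBlocks₁₂.toRows₂ * (1 + parBut G j * extL S G j * (permS S j).toBlocks₂₂)

/-- `Ē²¹` of the extended environment of subsystem `j`. -/
def extEnv21 (S : Matrix (Fin pC ⊕ Stack m) (Fin mC ⊕ Stack p) (RatFunc ℂ))
    (G : ∀ j, Matrix (Fin (p j)) (Fin (m j)) (RatFunc ℂ)) (j : Fin k) :
    Matrix (StackBut m j) (Fin (p j)) (RatFunc ℂ) :=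
  extL S G j * (permS S j).toBlocks₂₁.toCols₂

/-- `Ē²²` of the extended environment of subsystem `j`. -/
def extEnv22 (S : Matrix (Fin pC ⊕ Stack m) (Fin mC ⊕ Stack p) (RatFunc ℂ))
    (G : ∀ j, Matrix (Fin (p j)) (Fin (m j)) (RatFunc ℂ)) (j : Fin k) :
    Matrix (StackBut m j) (StackBut p j) (RatFunc ℂ) :=
  extL S G j * (permS S j).toBlocks₂₂

/-- The system `N` for subsystem abstraction, with inputs `(d_A, d_F, d_C | w)` and
outputs `(v_A, v_F, v_C | z)`. -/
def sysNS (S : Matrix (Fin pC ⊕ Stack m) (Fin mC ⊕ Stack p) (RatFunc ℂ))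
    (G : ∀ j, Matrix (Fin (p j)) (Fin (m j)) (RatFunc ℂ)) :
    Matrix (((Σ j, StackBut m j) ⊕ (Stack m ⊕ Σ j, StackBut m j)) ⊕ Fin pC)
      (((Σ j, StackBut p j) ⊕ (Stack p ⊕ Σ j, StackBut p j)) ⊕ Fin mC) (RatFunc ℂ) :=
  let M := sysM S G
  let E11 : Matrix (Stack m) (Stack p) (RatFunc ℂ) := blockDiagonal' (extEnv11 S G)
  let E12 : Matrix (Stack m) (Σ j, StackBut p j) (RatFunc ℂ) := blockDiagonal' (extEnv12 S G)
  let E21 : Matrix (Σ j, StackBut m j) (Stack p) (RatFunc ℂ) := blockDiagonal' (extEnv21 S G)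
  let E22 : Matrix (Σ j, StackBut m j) (Σ j, StackBut p j) (RatFunc ℂ) :=
    blockDiagonal' (extEnv22 S G)
  let Y := S.toBlocks₂₂ - E11
  let S12 := S.toBlocks₁₂
  let S21 := S.toBlocks₂₁
  fromBlocks
    (block33
      (E22 - E21 * M * E12)   (E21 * (1 + M * Y)) (E21 * M * E12)
      (-(Y * M * E12) - E12)  (Y * (1 + M * Y))   (Y * M * E12)
      (-(E21 * M * E12))      (E21 * M * Y)       (E22 + E21 * M * E12))
    (fromRows (E21 * M * S21) (fromRows ((1 + Y * M) * S21) (E21 * M * S21)))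
    (fromCols (-(S12 * M * E12)) (fromCols (S12 * (1 + M * Y)) (S12 * M * E12)))
    0

/-! ## Collected weights -/

/-- `diag(X_A¹,…,X_Aᵏ, X_F¹,…,X_Fᵏ, X_A¹,…,X_Aᵏ, X_C)`: collected weights for environment
abstraction. -/
def weightE {a b : Fin k → ℕ} {c : ℕ}
    (XA : ∀ j, Matrix (Fin (a j)) (Fin (a j)) (RatFunc ℂ))
    (XF : ∀ j, Matrix (Fin (b j)) (Fin (b j)) (RatFunc ℂ))
    (XC : Matrix (Fin c) (Fin c) (RatFunc ℂ)) :
    Matrix ((Stack a ⊕ (Stack b ⊕ Stack a)) ⊕ Fin c)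
      ((Stack a ⊕ (Stack b ⊕ Stack a)) ⊕ Fin c) (RatFunc ℂ) :=
  diag2 (diag2 (par XA) (diag2 (par XF) (par XA))) XC

/-- `diag(X̄_A¹,…,X̄_Aᵏ, X_F¹,…,X_Fᵏ, X̄_A¹,…,X̄_Aᵏ, X_C)` where `X̄_Aʲ` is the parallel
connection of all `X_Aˡ`, `l ≠ j`: collected weights for subsystem abstraction. -/
def weightS {a b : Fin k → ℕ} {c : ℕ}
    (XA : ∀ j, Matrix (Fin (a j)) (Fin (a j)) (RatFunc ℂ))
    (XF : ∀ j, Matrix (Fin (b j)) (Fin (b j)) (RatFunc ℂ))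
    (XC : Matrix (Fin c) (Fin c) (RatFunc ℂ)) :
    Matrix (((Σ j, StackBut a j) ⊕ (Stack b ⊕ Σ j, StackBut a j)) ⊕ Fin c)
      (((Σ j, StackBut a j) ⊕ (Stack b ⊕ Σ j, StackBut a j)) ⊕ Fin c) (RatFunc ℂ) :=
  diag2 (diag2 (blockDiagonal' (parBut XA)) (diag2 (par XF) (blockDiagonal' (parBut XA)))) XC

/-! ## Scalings -/

/-- The sorted scaling
`diag(S¹ ⊗ I_{a₁}, …, Sᵏ ⊗ I_{aₖ}, d¹ I_{b₁}, …, dᵏ I_{bₖ}, I_c)`, where `Sʲ` acts on the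
repetitions `ρ j` of the `j`-th abstraction error. -/
def sortedScaling {ρ : Fin k → Type} (Sc : ∀ j, Matrix (ρ j) (ρ j) ℂ) (d : Fin k → ℝ)
    (a b : Fin k → ℕ) (c : ℕ) :
    Matrix ((Σ j, ρ j × Fin (a j)) ⊕ (Stack b ⊕ Fin c))
      ((Σ j, ρ j × Fin (a j)) ⊕ (Stack b ⊕ Fin c)) ℂ :=
  diag2 (blockDiagonal' fun j => Sc j ⊗ₖ (1 : Matrix (Fin (a j)) (Fin (a j)) ℂ))
    (diag2 (blockDiagonal' fun j => (d j : ℂ) • (1 : Matrix (Fin (b j)) (Fin (b j)) ℂ)) 1)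

/-- Sorting of the channels for environment abstraction: the `j`-th abstraction error occurs
twice, once in the first group and once in the third group. -/
def sortE (a b : Fin k → ℕ) (c : ℕ) :
    (Stack a ⊕ (Stack b ⊕ Stack a)) ⊕ Fin c →
      (Σ j : Fin k, Fin 2 × Fin (a j)) ⊕ (Stack b ⊕ Fin c)
  | Sum.inl (Sum.inl ⟨j, x⟩) => Sum.inl ⟨j, (0, x)⟩
  | Sum.inl (Sum.inr (Sum.inl x)) => Sum.inr (Sum.inl x)
  | Sum.inl (Sum.inr (Sum.inr ⟨j, x⟩)) => Sum.inl ⟨j, (1, x)⟩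
  | Sum.inr e => Sum.inr (Sum.inr e)

/-- Sorting of the channels for subsystem abstraction: the `l`-th abstraction error occurs in the
first and in the third group, and there in the environment of every `j ≠ l`. -/
def sortS (a b : Fin k → ℕ) (c : ℕ) :
    ((Σ j, StackBut a j) ⊕ (Stack b ⊕ Σ j, StackBut a j)) ⊕ Fin c →
      (Σ l : Fin k, (Fin 2 × {j : Fin k // j ≠ l}) × Fin (a l)) ⊕ (Stack b ⊕ Fin c)
  | Sum.inl (Sum.inl ⟨j, ⟨l, x⟩⟩) => Sum.inl ⟨l, ((0, ⟨j, l.2.symm⟩), x)⟩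
  | Sum.inl (Sum.inr (Sum.inl x)) => Sum.inr (Sum.inl x)
  | Sum.inl (Sum.inr (Sum.inr ⟨j, ⟨l, x⟩⟩)) => Sum.inl ⟨l, ((1, ⟨j, l.2.symm⟩), x)⟩
  | Sum.inr e => Sum.inr (Sum.inr e)

/-- The set of scaling pairs `(D_ℓ, D_r)` for environment abstraction. Reindexing along the
sorting map is conjugation by the corresponding permutation matrix. -/
def scalingsE (m p : Fin k → ℕ) (mC pC : ℕ) :
    Set (Matrix ((Stack p ⊕ (Stack m ⊕ Stack p)) ⊕ Fin pC)
          ((Stack p ⊕ (Stack m ⊕ Stack p)) ⊕ Fin pC) ℂ ×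
        Matrix ((Stack m ⊕ (Stack p ⊕ Stack m)) ⊕ Fin mC)
          ((Stack m ⊕ (Stack p ⊕ Stack m)) ⊕ Fin mC) ℂ) :=
  {D | ∃ (Sc : Fin k → Matrix (Fin 2) (Fin 2) ℂ) (d : Fin k → ℝ),
    (∀ j, (Sc j).PosDef) ∧ (∀ j, 0 < d j) ∧
    D.1 = (sortedScaling Sc d p m pC).submatrix (sortE p m pC) (sortE p m pC) ∧
    D.2 = (sortedScaling Sc d m p mC).submatrix (sortE m p mC) (sortE m p mC)}

/-- The set of scaling pairs `(D_ℓ, D_r)` for subsystem abstraction. -/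
def scalingsS (m p : Fin k → ℕ) (mC pC : ℕ) :
    Set (Matrix (((Σ j, StackBut m j) ⊕ (Stack m ⊕ Σ j, StackBut m j)) ⊕ Fin pC)
          (((Σ j, StackBut m j) ⊕ (Stack m ⊕ Σ j, StackBut m j)) ⊕ Fin pC) ℂ ×
        Matrix (((Σ j, StackBut p j) ⊕ (Stack p ⊕ Σ j, StackBut p j)) ⊕ Fin mC)
          (((Σ j, StackBut p j) ⊕ (Stack p ⊕ Σ j, StackBut p j)) ⊕ Fin mC) ℂ) :=
  {D | ∃ (Sc : ∀ l : Fin k, Matrix (Fin 2 × {j : Fin k // j ≠ l}) (Fin 2 × {j : Fin k // j ≠ l}) ℂ)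
      (d : Fin k → ℝ),
    (∀ l, (Sc l).PosDef) ∧ (∀ j, 0 < d j) ∧
    D.1 = (sortedScaling Sc d m m pC).submatrix (sortS m m pC) (sortS m m pC) ∧
    D.2 = (sortedScaling Sc d p p mC).submatrix (sortS p p mC) (sortS p p mC)}

end Interconnection

/-- The scaled frequency-domain inequality `𝒩(iω) D_r 𝒩(iω)ᴴ ⪯ η D_ℓ` for all real `ω`. -/
def ScaledBound {a b : Type*} [Fintype a] [Fintype b]
    (N : Matrix a b (RatFunc ℂ)) (D : Matrix a a ℂ × Matrix b b ℂ) (η : ℝ) : Prop :=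
  ∀ ω : ℝ, ((η : ℂ) • D.1 - freqResp N ω * D.2 * (freqResp N ω)ᴴ).PosSemidef

end

/-! Write $A$ for the block-diagonal collection of abstraction errors and
$F=\operatorname{diag}(\tilde E_F^j)$. The reduced interconnection is the nominal one seen through
an upper feedback loop: with $\Delta=\operatorname{diag}(A,F,A)$, one has
$E_C=N_{21}\Delta(I-N_{11}\Delta)^{-1}N_{12}$. The proof therefore combines an algebraic identity
with a robust performance argument.

Algebra. Let $T,T'$ be the loops of the original and of the reduced subsystems with their abstracted
environments; the constant matrices $G_u,G_y$ cancel and $F=T'-T$ (`par_redErrorNorm`). With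
$Z=S_{22}-\operatorname{diag}(\hat E^j_{22})$ the full nominal loop satisfies $M=T(I+ZM)$, and the
loop closed by $\Delta$ yields $M'$ with $M'=T'(I+ZM')$, hence $M'=\hat\Sigma_B(I+S_{22}M')$
(`closedLoop_of_error`, `perturbed_closedLoop`). The error $A$ occurs twice because the abstracted
environment is driven once by $M'$ and once by $M'$ minus the output of $F$. Both kinds of
abstraction fit one scheme: all that is used of the channels `E12`, `E21`, `E22` is that closing
them by $A$ produces $R=\operatorname{diag}(\hat E^j_{22})-\bar E$, with $\bar E$ the nominal
environment. Once $M'$ is stable, well-posedness and internal stability follow, since every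
closed-loop map is polynomial in $S$ and $M'$ (`wellPosed_of_closedLoop`).

Analysis. Since $Q\otimes I$ commutes past $I\otimes\Delta_A^j$, norm bounds by $\gamma$ give
$\Delta D_\ell\Delta^H\preceq\gamma^2D_r$ (`errorScaling_sub_posSemidef`). Together with the
inequality for $\mathcal N$ at rate $\eta$, where $\eta\gamma^2<1$ by the strictness assumption
(`exists_rates`), this makes $N_{11}\Delta$ a strict contraction in the metric of $D_\ell$ on the
imaginary axis. Phragmén–Lindelöf carries the bound to the right half-plane, so
$\det(I-N_{11}\Delta)$ stays away from zero there and the inverse is in $\mathcal{RH}_\infty$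
(`small_gain`). The same inequality, tested on suitable block rows, bounds the performance channel
by $(2-\eta\gamma^2)^{-1/2}<1$ uniformly in frequency (`performance_posSemidef`). -/

noncomputable section

/-! ## Scalar transfer functions -/

/-- The field of real rational functions inside the complex rational functions. -/
def realRational : Subfield (RatFunc ℂ) where
  carrier := {f | IsRealRational f}
  mul_mem' := by
    rintro _ _ ⟨a, b, hb, rfl⟩ ⟨c, d, hd, rfl⟩
    exact ⟨a * c, b * d, mul_ne_zero hb hd, by
      simp only [Polynomial.map_mul, map_mul, div_mul_div_comm]⟩
  one_mem' := ⟨1, 1, one_ne_zero, by simp⟩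
  add_mem' := by
    rintro _ _ ⟨a, b, hb, rfl⟩ ⟨c, d, hd, rfl⟩
    have h (q : Polynomial ℝ) (hq : q ≠ 0) :
        algebraMap (Polynomial ℂ) (RatFunc ℂ) (q.map Complex.ofRealHom) ≠ 0 :=
      RatFunc.algebraMap_ne_zero
        ((Polynomial.map_ne_zero_iff Complex.ofRealHom.injective).mpr hq)
    refine ⟨a * d + b * c, b * d, mul_ne_zero hb hd, ?_⟩
    rw [div_add_div _ _ (h b hb) (h d hd)]
    simp only [Polynomial.map_mul, Polynomial.map_add, map_mul, map_add]
  zero_mem' := ⟨0, 1, one_ne_zero, by simp⟩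
  neg_mem' := by
    rintro _ ⟨a, b, hb, rfl⟩
    exact ⟨-a, b, hb, by
      rw [Polynomial.map_neg, map_neg]
      exact (_root_.neg_div _ _).symm⟩
  inv_mem' := by
    rintro _ ⟨a, b, hb, rfl⟩
    by_cases ha : a = 0
    · exact ⟨0, 1, one_ne_zero, by simp [ha]⟩
    · exact ⟨b, a, ha, by rw [inv_div]⟩

/-- Quotients of polynomials with no pole in the closed right half-plane, nor at infinity. -/
def IsStableProperQuotient (f : RatFunc ℂ) : Prop :=
  ∃ a b : Polynomial ℂ, b ≠ 0 ∧ a.natDegree ≤ b.natDegree ∧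
    (∀ s : ℂ, b.eval s = 0 → s.re < 0) ∧
    f = algebraMap (Polynomial ℂ) (RatFunc ℂ) a / algebraMap (Polynomial ℂ) (RatFunc ℂ) b

/-- Cancelling common factors preserves the difference of degrees and can only remove zeros of the
denominator. Hence any representing quotient may be used, which matters because sums and products of
reduced fractions need not be reduced. -/
theorem isStableProperQuotient_iff (f : RatFunc ℂ) :
    IsStableProperQuotient f ↔ IsProperFn f ∧ IsStableFn f := by
  constructor
  · rintro ⟨a, b, hb, hab, hs, rfl⟩
    constructor
    · set f := algebraMap (Polynomial ℂ) (RatFunc ℂ) a /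
        algebraMap (Polynomial ℂ) (RatFunc ℂ) b with hf
      by_cases ha : a = 0
      · simp [IsProperFn, hf, ha]
      have h := RatFunc.num_div_dvd a hb
      have h2 : f.num * b = a * f.denom := (RatFunc.num_mul_eq_mul_denom_iff hb).mpr hf
      have hn : f.num ≠ 0 := by
        intro h0
        rw [h0, zero_mul] at h2
        exact mul_ne_zero ha (RatFunc.denom_ne_zero f) h2.symm
      have h3 := congrArg Polynomial.natDegree h2
      rw [Polynomial.natDegree_mul hn hb, Polynomial.natDegree_mul ha (RatFunc.denom_ne_zero f)] at h3
      simp only [IsProperFn]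
      omega
    · intro s h
      obtain ⟨c, hc⟩ := RatFunc.denom_div_dvd a b
      apply hs
      rw [hc, Polynomial.eval_mul, h, zero_mul]
  · rintro ⟨hp, hs⟩
    exact ⟨f.num, f.denom, RatFunc.denom_ne_zero f, hp, hs, (RatFunc.num_div_denom f).symm⟩

theorem Polynomial.natDegree_mul_add_mul_le {a b c d : Polynomial ℂ} (hb : b ≠ 0) (hd : d ≠ 0)
    (h₁ : a.natDegree ≤ b.natDegree) (h₂ : c.natDegree ≤ d.natDegree) :
    (a * d + b * c).natDegree ≤ (b * d).natDegree := by
  rw [Polynomial.natDegree_mul hb hd]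
  refine (Polynomial.natDegree_add_le _ _).trans (max_le ?_ ?_)
  · exact Polynomial.natDegree_mul_le.trans (by omega)
  · exact Polynomial.natDegree_mul_le.trans (by omega)

/-- The ring of proper, stable, real rational functions. -/
def rhInf : Subring (RatFunc ℂ) where
  carrier := {f | IsRealRational f ∧ IsProperFn f ∧ IsStableFn f}
  mul_mem' := by
    rintro f g ⟨hf, hf'⟩ ⟨hg, hg'⟩
    refine ⟨realRational.mul_mem hf hg, ?_⟩
    rw [← isStableProperQuotient_iff] at *
    obtain ⟨a, b, hb, hab, hs, rfl⟩ := hf'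
    obtain ⟨c, d, hd, hcd, ht, rfl⟩ := hg'
    refine ⟨a * c, b * d, mul_ne_zero hb hd, ?_, ?_, ?_⟩
    · rw [Polynomial.natDegree_mul hb hd]
      exact Polynomial.natDegree_mul_le.trans (by omega)
    · intro s h
      rw [Polynomial.eval_mul] at h
      exact (mul_eq_zero.mp h).elim (hs s) (ht s)
    · simp only [map_mul, div_mul_div_comm]
  one_mem' := ⟨realRational.one_mem, (isStableProperQuotient_iff 1).mp
    ⟨1, 1, one_ne_zero, le_rfl, by simp, by simp⟩⟩
  add_mem' := by
    rintro f g ⟨hf, hf'⟩ ⟨hg, hg'⟩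
    refine ⟨realRational.add_mem hf hg, ?_⟩
    rw [← isStableProperQuotient_iff] at *
    obtain ⟨a, b, hb, hab, hs, rfl⟩ := hf'
    obtain ⟨c, d, hd, hcd, ht, rfl⟩ := hg'
    refine ⟨a * d + b * c, b * d, mul_ne_zero hb hd,
      Polynomial.natDegree_mul_add_mul_le hb hd hab hcd, ?_, ?_⟩
    · intro s h
      rw [Polynomial.eval_mul] at h
      exact (mul_eq_zero.mp h).elim (hs s) (ht s)
    · rw [div_add_div _ _ (RatFunc.algebraMap_ne_zero hb) (RatFunc.algebraMap_ne_zero hd)]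
      simp only [map_mul, map_add]
  zero_mem' := ⟨realRational.zero_mem, (isStableProperQuotient_iff 0).mp
    ⟨0, 1, one_ne_zero, by simp, by simp, by simp⟩⟩
  neg_mem' := by
    rintro f ⟨hf, hf'⟩
    refine ⟨realRational.neg_mem hf, ?_⟩
    rw [← isStableProperQuotient_iff] at *
    obtain ⟨a, b, hb, hab, hs, rfl⟩ := hf'
    exact ⟨-a, b, hb, by simpa using hab, hs, by
      rw [map_neg]
      exact (_root_.neg_div _ _).symm⟩

/-- Evaluation of a rational function at a point of the complex plane. -/
def evalAt (s : ℂ) (f : RatFunc ℂ) : ℂ := f.eval (RingHom.id ℂ) s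

theorem evalAt_eq (s : ℂ) (f : RatFunc ℂ) : evalAt s f = f.num.eval s / f.denom.eval s := by
  simp [evalAt, RatFunc.eval, Polynomial.eval₂_id]

theorem denom_eval_ne_zero {f : RatFunc ℂ} (hf : f ∈ rhInf) {s : ℂ} (hs : 0 ≤ s.re) :
    f.denom.eval s ≠ 0 := fun h => absurd (hf.2.2 s h) (not_lt.mpr hs)

/-- Evaluation at a point of the closed right half-plane, as a ring homomorphism. -/
def evalHom (s : ℂ) (hs : 0 ≤ s.re) : rhInf →+* ℂ where
  toFun f := evalAt s f
  map_one' := RatFunc.eval_one _ _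
  map_zero' := RatFunc.eval_zero _ _
  map_mul' f g := RatFunc.eval_mul _ _ (by simpa using denom_eval_ne_zero f.2 hs)
    (by simpa using denom_eval_ne_zero g.2 hs)
  map_add' f g := RatFunc.eval_add _ _ (by simpa using denom_eval_ne_zero f.2 hs)
    (by simpa using denom_eval_ne_zero g.2 hs)

theorem differentiableAt_evalAt {f : RatFunc ℂ} (hf : f ∈ rhInf) {s : ℂ} (hs : 0 ≤ s.re) :
    DifferentiableAt ℂ (fun s => evalAt s f) s := by
  simp only [evalAt_eq]
  exact f.num.differentiableAt.div f.denom.differentiableAt (denom_eval_ne_zero hf hs)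

/-- A proper stable function is bounded on the closed right half-plane. -/
theorem exists_bound_evalAt {f : RatFunc ℂ} (hf : f ∈ rhInf) :
    ∃ C : ℝ, ∀ s : ℂ, 0 ≤ s.re → ‖evalAt s f‖ ≤ C := by
  have hdeg : f.num.degree ≤ f.denom.degree :=
    by
    rw [Polynomial.degree_eq_natDegree (RatFunc.denom_ne_zero f)]
    exact Polynomial.degree_le_of_natDegree_le hf.2.1
  obtain ⟨c, hc⟩ := (Polynomial.isBigO_cobounded_of_degree_le hdeg).bound
  obtain ⟨r, hr⟩ := (Metric.hasBasis_cobounded_compl_closedBall (0 : ℂ)).eventually_iff.mp hc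
  -- The degree condition controls the function outside a disc; what remains of the half-plane is a
  -- compact half-disc without poles.
  have hK : IsCompact (Metric.closedBall (0 : ℂ) r ∩ {s | 0 ≤ s.re}) :=
    (isCompact_closedBall 0 r).inter_right (isClosed_le continuous_const Complex.continuous_re)
  obtain ⟨C, hC⟩ := hK.exists_bound_of_continuousOn (f := fun s => evalAt s f)
    (fun s hs => (differentiableAt_evalAt hf hs.2).continuousAt.continuousWithinAt)
  refine ⟨max C c, fun s hs => ?_⟩
  by_cases h : s ∈ Metric.closedBall (0 : ℂ) r
  · exact (hC s ⟨h, hs⟩).trans (le_max_left _ _)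
  · refine le_trans ?_ (le_max_right _ _)
    rw [evalAt_eq, norm_div, div_le_iff₀ (norm_pos_iff.mpr (denom_eval_ne_zero hf hs))]
    exact hr.2 h

/-- A proper stable function that is bounded away from zero on the closed right half-plane is
invertible in `RH∞`. -/
theorem inv_mem_rhInf {f : RatFunc ℂ} (hf : f ∈ rhInf) {c : ℝ} (hc : 0 < c)
    (h : ∀ s : ℂ, 0 ≤ s.re → c ≤ ‖evalAt s f‖) : f⁻¹ ∈ rhInf := by
  refine ⟨realRational.inv_mem hf.1, (isStableProperQuotient_iff _).mp ?_⟩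
  have hne (s : ℂ) (hs : 0 ≤ s.re) : f.num.eval s ≠ 0 := by
    intro h0
    have := h s hs
    rw [evalAt_eq, h0, zero_div, norm_zero] at this
    linarith
  have hnum : f.num ≠ 0 := by
    intro h0
    exact hne 0 le_rfl (by simp [h0])
  refine ⟨f.denom, f.num, hnum, ?_, ?_, ?_⟩
  -- Properness of the inverse: if the numerator had smaller degree, the function would tend to zero
  -- at infinity, against the lower bound. The point $|r|+1$ lies outside the disc and inside the
  -- half-plane.
  · by_contra hlt
    push Not at hlt
    have hdeg : f.num.degree < f.denom.degree := Polynomial.degree_lt_degree hlt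
    have ho := (Polynomial.isLittleO_cobounded_of_degree_lt hdeg).def (half_pos hc)
    obtain ⟨r, hr⟩ := (Metric.hasBasis_cobounded_compl_closedBall (0 : ℂ)).eventually_iff.mp ho
    have hs : 0 ≤ ((|r| + 1 : ℝ) : ℂ).re := by simp; positivity
    have h1 := hr.2 (x := ((|r| + 1 : ℝ) : ℂ)) (by
      simp only [Set.mem_compl_iff, mem_closedBall_zero_iff, Complex.norm_real, Real.norm_eq_abs]
      rw [abs_of_nonneg (by positivity)]
      have := le_abs_self r
      linarith)
    have h2 := h _ hs
    have hd := norm_pos_iff.mpr (denom_eval_ne_zero hf hs)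
    rw [evalAt_eq, norm_div, le_div_iff₀ hd] at h2
    nlinarith
  · intro s h0
    by_contra hs
    exact hne s (not_lt.mp hs) h0
  · conv_lhs => rw [← RatFunc.num_div_denom f]
    rw [inv_div]

/-! ## Matrices over `RH∞` -/

namespace InRHinf

variable {a b c d e f : Type*}

theorem zero : InRHinf (0 : Matrix a b (RatFunc ℂ)) := fun _ _ => rhInf.zero_mem

theorem one [DecidableEq a] : InRHinf (1 : Matrix a a (RatFunc ℂ)) := fun i j => by
  rw [Matrix.one_apply]
  split
  · exact rhInf.one_mem
  · exact rhInf.zero_mem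

theorem add {G H : Matrix a b (RatFunc ℂ)} (hG : InRHinf G) (hH : InRHinf H) :
    InRHinf (G + H) := fun i j => rhInf.add_mem (hG i j) (hH i j)

theorem neg {G : Matrix a b (RatFunc ℂ)} (hG : InRHinf G) : InRHinf (-G) :=
  fun i j => rhInf.neg_mem (hG i j)

theorem sub {G H : Matrix a b (RatFunc ℂ)} (hG : InRHinf G) (hH : InRHinf H) :
    InRHinf (G - H) := fun i j => rhInf.sub_mem (hG i j) (hH i j)

theorem mul [Fintype b] {G : Matrix a b (RatFunc ℂ)} {H : Matrix b c (RatFunc ℂ)}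
    (hG : InRHinf G) (hH : InRHinf H) : InRHinf (G * H) :=
  fun i j => rhInf.sum_mem fun l _ => rhInf.mul_mem (hG i l) (hH l j)

theorem smul {G : Matrix a b (RatFunc ℂ)} {r : RatFunc ℂ} (hr : r ∈ rhInf) (hG : InRHinf G) :
    InRHinf (r • G) := fun i j => rhInf.mul_mem hr (hG i j)

theorem submatrix {G : Matrix a b (RatFunc ℂ)} (hG : InRHinf G) (r : c → a) (s : d → b) :
    InRHinf (G.submatrix r s) := fun i j => hG (r i) (s j)

theorem fromRows {G : Matrix a c (RatFunc ℂ)} {H : Matrix b c (RatFunc ℂ)}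
    (hG : InRHinf G) (hH : InRHinf H) : InRHinf (Matrix.fromRows G H)
  | Sum.inl i, j => hG i j
  | Sum.inr i, j => hH i j

theorem fromCols {G : Matrix c a (RatFunc ℂ)} {H : Matrix c b (RatFunc ℂ)}
    (hG : InRHinf G) (hH : InRHinf H) : InRHinf (Matrix.fromCols G H)
  | i, Sum.inl j => hG i j
  | i, Sum.inr j => hH i j

theorem fromBlocks {A : Matrix a c (RatFunc ℂ)} {B : Matrix a d (RatFunc ℂ)}
    {C : Matrix b c (RatFunc ℂ)} {D : Matrix b d (RatFunc ℂ)}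
    (hA : InRHinf A) (hB : InRHinf B) (hC : InRHinf C) (hD : InRHinf D) :
    InRHinf (Matrix.fromBlocks A B C D)
  | Sum.inl i, Sum.inl j => hA i j
  | Sum.inl i, Sum.inr j => hB i j
  | Sum.inr i, Sum.inl j => hC i j
  | Sum.inr i, Sum.inr j => hD i j

theorem diag2 {A : Matrix a b (RatFunc ℂ)} {B : Matrix c d (RatFunc ℂ)} (hA : InRHinf A)
    (hB : InRHinf B) : InRHinf (diag2 A B) := fromBlocks hA zero zero hB

theorem blockDiagonal' {ι : Type*} [DecidableEq ι] {r s : ι → Type*}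
    {G : ∀ i, Matrix (r i) (s i) (RatFunc ℂ)} (hG : ∀ i, InRHinf (G i)) :
    InRHinf (Matrix.blockDiagonal' G) := by
  rintro ⟨i, x⟩ ⟨j, y⟩
  rw [Matrix.blockDiagonal'_apply]
  split
  · exact hG _ _ _
  · exact rhInf.zero_mem

theorem isTransfer {G : Matrix a b (RatFunc ℂ)} (hG : InRHinf G) : IsTransfer G :=
  fun i j => ⟨(hG i j).1, (hG i j).2.1⟩

/-- Passing to matrices over the subring `rhInf` makes determinants, adjugates and point evaluation
instances of ring homomorphisms. Over all rational functions evaluation is not multiplicative,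
because of poles. -/
theorem exists_lift {G : Matrix a b (RatFunc ℂ)} (hG : InRHinf G) :
    ∃ G' : Matrix a b rhInf, G = G'.map rhInf.subtype :=
  ⟨Matrix.of fun i j => ⟨G i j, hG i j⟩, by ext; rfl⟩

theorem det [Fintype a] [DecidableEq a] {G : Matrix a a (RatFunc ℂ)} (hG : InRHinf G) :
    G.det ∈ rhInf := by
  obtain ⟨G', rfl⟩ := hG.exists_lift
  rw [← RingHom.mapMatrix_apply, ← RingHom.map_det]
  exact G'.det.2

theorem adjugate [Fintype a] [DecidableEq a] {G : Matrix a a (RatFunc ℂ)} (hG : InRHinf G) :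
    InRHinf G.adjugate := by
  obtain ⟨G', rfl⟩ := hG.exists_lift
  rw [← RingHom.mapMatrix_apply, ← RingHom.map_adjugate]
  exact fun i j => (G'.adjugate i j).2

theorem of_inv_det [Fintype a] [DecidableEq a] {G : Matrix a a (RatFunc ℂ)} (hG : InRHinf G)
    (h : G.det⁻¹ ∈ rhInf) : InRHinf G⁻¹ := by
  rw [Matrix.inv_def, Ring.inverse_eq_inv']
  exact hG.adjugate.smul h

end InRHinf

/-- The value of a transfer function matrix at a point of the complex plane. -/
def evalMat {a b : Type*} (s : ℂ) (G : Matrix a b (RatFunc ℂ)) : Matrix a b ℂ := G.map (evalAt s)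

/-! ### Evaluation of matrices in the closed right half-plane -/

section evalMat

variable {a b c d : Type*} {s : ℂ}

theorem freqResp_eq_evalMat (G : Matrix a b (RatFunc ℂ)) (ω : ℝ) :
    freqResp G ω = evalMat (Complex.I * ω) G := rfl

theorem I_mul_re_nonneg (ω : ℝ) : 0 ≤ (Complex.I * ω).re := by simp

theorem evalMat_map_subtype (hs : 0 ≤ s.re) (G : Matrix a b rhInf) :
    evalMat s (G.map rhInf.subtype) = G.map (evalHom s hs) := rfl

theorem evalMat_mul [Fintype b] {G : Matrix a b (RatFunc ℂ)} {H : Matrix b c (RatFunc ℂ)}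
    (hs : 0 ≤ s.re) (hG : InRHinf G) (hH : InRHinf H) :
    evalMat s (G * H) = evalMat s G * evalMat s H := by
  obtain ⟨G, rfl⟩ := hG.exists_lift
  obtain ⟨H, rfl⟩ := hH.exists_lift
  rw [← Matrix.map_mul, evalMat_map_subtype hs, evalMat_map_subtype hs, evalMat_map_subtype hs,
    Matrix.map_mul]

theorem evalMat_one_sub [DecidableEq a] {G : Matrix a a (RatFunc ℂ)} (hs : 0 ≤ s.re)
    (hG : InRHinf G) : evalMat s (1 - G) = 1 - evalMat s G := by
  obtain ⟨G, rfl⟩ := hG.exists_lift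
  have : (1 : Matrix a a (RatFunc ℂ)) = (1 : Matrix a a rhInf).map rhInf.subtype := by simp
  rw [this, ← Matrix.map_sub _ (fun _ _ => rfl), evalMat_map_subtype hs, evalMat_map_subtype hs,
    Matrix.map_sub _ (map_sub _)]
  simp

theorem evalAt_det [Fintype a] [DecidableEq a] {G : Matrix a a (RatFunc ℂ)} (hs : 0 ≤ s.re)
    (hG : InRHinf G) : evalAt s G.det = (evalMat s G).det := by
  obtain ⟨G, rfl⟩ := hG.exists_lift
  rw [evalMat_map_subtype hs, ← RingHom.mapMatrix_apply, ← RingHom.map_det,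
    ← RingHom.mapMatrix_apply, ← RingHom.map_det]
  rfl

end evalMat

/-! ### Spectral norm bounds as semidefinite inequalities -/

section PSD

open scoped Matrix.Norms.L2Operator MatrixOrder

variable {a b : Type*} [Fintype a] [Fintype b] [DecidableEq a] [DecidableEq b]

theorem norm_sq_smul_one_sub_posSemidef {B : Matrix a b ℂ} {c : ℝ} (hB : ‖B‖ ≤ c) :
    (((c ^ 2 : ℝ) : ℂ) • (1 : Matrix a a ℂ) - B * Bᴴ).PosSemidef := by
  rw [← Matrix.le_iff]
  have h1 : B * Bᴴ ≤ algebraMap ℝ (Matrix a a ℂ) ‖B * Bᴴ‖ :=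
    IsSelfAdjoint.le_algebraMap_norm_self (Matrix.isHermitian_mul_conjTranspose_self B)
  have h2 : ‖B * Bᴴ‖ = ‖B‖ * ‖B‖ := by
    have := l2_opNorm_conjTranspose_mul_self Bᴴ
    rwa [conjTranspose_conjTranspose, l2_opNorm_conjTranspose] at this
  have h3 : algebraMap ℝ (Matrix a a ℂ) ‖B * Bᴴ‖ ≤ algebraMap ℝ (Matrix a a ℂ) (c ^ 2) := by
    apply algebraMap_mono
    rw [h2]
    nlinarith [norm_nonneg B]
  refine (h1.trans h3).trans_eq ?_
  rw [Algebra.algebraMap_eq_smul_one]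
  ext i j
  simp

theorem norm_le_of_posSemidef {B : Matrix a b ℂ} {c : ℝ} (hc : 0 ≤ c)
    (h : (((c ^ 2 : ℝ) : ℂ) • (1 : Matrix a a ℂ) - B * Bᴴ).PosSemidef) : ‖B‖ ≤ c := by
  rw [← Matrix.le_iff] at h
  have h2 : ‖B * Bᴴ‖ = ‖B‖ * ‖B‖ := by
    have := l2_opNorm_conjTranspose_mul_self Bᴴ
    rwa [conjTranspose_conjTranspose, l2_opNorm_conjTranspose] at this
  have h1 := CStarAlgebra.norm_le_norm_of_nonneg_of_le
    (posSemidef_self_mul_conjTranspose B).nonneg h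
  have h3 : ‖((c ^ 2 : ℝ) : ℂ) • (1 : Matrix a a ℂ)‖ ≤ c ^ 2 := by
    rw [norm_smul]
    have : ‖(1 : Matrix a a ℂ)‖ ≤ 1 := by
      -- For an empty index type the identity is the zero matrix, of norm 0 rather than 1.
      rcases isEmpty_or_nonempty a with h | h
      · rw [Subsingleton.elim (1 : Matrix a a ℂ) 0, norm_zero]
        exact zero_le_one
      · exact CStarRing.norm_one.le
    rw [Complex.norm_real, Real.norm_of_nonneg (sq_nonneg c)]
    exact mul_le_of_le_one_right (sq_nonneg c) this
  rw [h2] at h1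
  exact abs_le_of_sq_le_sq' (by nlinarith) hc |>.2

theorem Matrix.PosDef.exists_factor {D : Matrix a a ℂ} (hD : D.PosDef) :
    ∃ T : Matrix a a ℂ, IsUnit T ∧ D = T * Tᴴ := by
  obtain ⟨b, hb, h⟩ := CStarAlgebra.isStrictlyPositive_iff_eq_star_mul_self.mp
    (isStrictlyPositive_iff_posDef.mpr hD)
  exact ⟨star b, hb.star, by rw [h, star_eq_conjTranspose, conjTranspose_conjTranspose]⟩

end PSD

/-! ### Maximum modulus and the scaled small gain theorem -/

section SmallGain

open scoped Matrix.Norms.L2Operator MatrixOrder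

variable {a : Type*} [Fintype a] [DecidableEq a]

/-- The maximum modulus principle on the right half-plane for matrices over `RH∞`. -/
theorem norm_conj_evalMat_le {H : Matrix a a (RatFunc ℂ)} (hH : InRHinf H) (A B : Matrix a a ℂ)
    {C : ℝ} (hC : ∀ ω : ℝ, ‖A * freqResp H ω * B‖ ≤ C) {s : ℂ} (hs : 0 ≤ s.re) :
    ‖A * evalMat s H * B‖ ≤ C := by
  -- A finite combination of constant matrices with scalar coefficients: differentiability and
  -- boundedness reduce to the entries.
  have hdec (s : ℂ) : A * evalMat s H * B =
      ∑ i, ∑ j, evalAt s (H i j) • (A * Matrix.single i j 1 * B) := by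
    conv_lhs => rw [Matrix.matrix_eq_sum_single (evalMat s H)]
    simp only [Matrix.mul_sum, Matrix.sum_mul]
    refine Finset.sum_congr rfl fun i _ => Finset.sum_congr rfl fun j _ => ?_
    rw [← Matrix.smul_mul, ← Matrix.mul_smul, Matrix.smul_single, smul_eq_mul, mul_one]
    rfl
  have hdiff (s : ℂ) (hs : 0 ≤ s.re) :
      DifferentiableAt ℂ (fun s => A * evalMat s H * B) s := by
    simp only [hdec]
    exact DifferentiableAt.fun_sum fun i _ => DifferentiableAt.fun_sum fun j _ =>
      (differentiableAt_evalAt (hH i j) hs).smul_const _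
  have hbdd : ∃ K : ℝ, ∀ s : ℂ, 0 ≤ s.re → ‖A * evalMat s H * B‖ ≤ K := by
    choose K hK using fun i j => exists_bound_evalAt (hH i j)
    refine ⟨∑ i, ∑ j, K i j * ‖A * Matrix.single i j 1 * B‖, fun s hs => ?_⟩
    rw [hdec]
    refine (norm_sum_le _ _).trans (Finset.sum_le_sum fun i _ => (norm_sum_le _ _).trans
      (Finset.sum_le_sum fun j _ => ?_))
    rw [norm_smul]
    exact mul_le_mul_of_nonneg_right (hK i j s hs) (norm_nonneg _)
  obtain ⟨K, hK⟩ := hbdd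
  -- The growth condition is met with exponent $1<2$ and constant $0$, that is, by plain
  -- boundedness.
  refine PhragmenLindelof.right_half_plane_of_bounded_on_real
    (f := fun s => A * evalMat s H * B) ?_ ⟨1, one_lt_two, 0, ?_⟩ ?_ ?_ hs
  · refine ⟨fun s hs => (hdiff s (le_of_lt hs)).differentiableWithinAt, fun s hs => ?_⟩
    have : 0 ≤ s.re := by
      rw [Complex.closure_setOfPred_lt_re] at hs
      exact hs
    exact (hdiff s this).continuousAt.continuousWithinAt
  · refine Asymptotics.IsBigO.of_bound K ?_
    filter_upwards [Filter.mem_inf_of_right (Filter.mem_principal_self _)] with s hs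
    simpa using hK s (le_of_lt hs)
  · refine ⟨K, ?_⟩
    rw [Filter.eventually_map]
    filter_upwards [Filter.eventually_ge_atTop (0 : ℝ)] with x hx
    exact hK x (by simpa using hx)
  · intro x
    rw [mul_comm]
    exact hC x

/-- The determinant is continuous and, by the Neumann series, nonzero on the compact ball of radius
$\theta<1$, so it attains a positive minimum modulus. A bound uniform in $X$ is needed to control
the half-plane up to infinity. -/
theorem exists_pos_le_norm_det_one_sub {θ : ℝ} (hθ : 0 ≤ θ) (hθ' : θ < 1) :
    ∃ c : ℝ, 0 < c ∧ ∀ X : Matrix a a ℂ, ‖X‖ ≤ θ → c ≤ ‖(1 - X).det‖ := by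
  have hprop : ProperSpace (Matrix a a ℂ) := FiniteDimensional.proper ℂ _
  have hcont : Continuous fun X : Matrix a a ℂ => ‖(1 - X).det‖ :=
    (Continuous.matrix_det (continuous_const.sub continuous_id)).norm
  obtain ⟨X₀, hX₀, hmin⟩ := (isCompact_closedBall (0 : Matrix a a ℂ) θ).exists_isMinOn
    ⟨0, by simpa using hθ⟩ hcont.continuousOn
  refine ⟨‖(1 - X₀).det‖, ?_, fun X hX => hmin (by simpa using hX)⟩
  have : IsUnit (1 - X₀) := isUnit_one_sub_of_norm_lt_one
    (lt_of_le_of_lt (by simpa using hX₀) hθ')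
  exact norm_pos_iff.mpr ((Matrix.isUnit_iff_isUnit_det _).mp this).ne_zero

/-- The scaled small gain theorem. -/
theorem small_gain {H : Matrix a a (RatFunc ℂ)} (hH : InRHinf H) {D : Matrix a a ℂ}
    (hD : D.PosDef) {θ : ℝ} (hθ : 0 ≤ θ) (hθ' : θ < 1)
    (hb : ∀ ω, ((θ : ℂ) • D - freqResp H ω * D * (freqResp H ω)ᴴ).PosSemidef) :
    IsUnit (1 - H).det ∧ InRHinf (1 - H)⁻¹ := by
  obtain ⟨T, hT, rfl⟩ := hD.exists_factor
  have hTd := (Matrix.isUnit_iff_isUnit_det _).mp hT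
  have hbound (ω : ℝ) : ‖T⁻¹ * freqResp H ω * T‖ ≤ √θ := by
    refine norm_le_of_posSemidef (Real.sqrt_nonneg θ) ?_
    have h := (hb ω).mul_mul_conjTranspose_same T⁻¹
    rw [Real.sq_sqrt hθ]
    convert h using 1
    have h1 : T⁻¹ * T = 1 := Matrix.nonsing_inv_mul T hTd
    have h2 : Tᴴ * T⁻¹ᴴ = 1 := by rw [← conjTranspose_mul, h1, conjTranspose_one]
    simp only [Matrix.mul_sub, Matrix.sub_mul, Matrix.mul_smul, Matrix.smul_mul,
      conjTranspose_mul]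
    congr 1
    · rw [← Matrix.mul_assoc, h1, Matrix.one_mul, h2]
    · simp only [Matrix.mul_assoc]
  obtain ⟨c, hc, hdet⟩ := exists_pos_le_norm_det_one_sub (a := a) (Real.sqrt_nonneg θ)
    (by rw [Real.sqrt_lt' one_pos]; simpa using hθ')
  -- The determinant is invariant under conjugation by $T$. The complex matrix $T$ acts on values
  -- only, so the transfer functions themselves stay real rational.
  have hdet' (s : ℂ) (hs : 0 ≤ s.re) : c ≤ ‖evalAt s (1 - H).det‖ := by
    rw [evalAt_det hs (InRHinf.one.sub hH), evalMat_one_sub hs hH]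
    have h1 := hdet _ (norm_conj_evalMat_le hH T⁻¹ T hbound hs)
    have h2 : 1 - T⁻¹ * evalMat s H * T = T⁻¹ * (1 - evalMat s H) * T := by
      rw [Matrix.mul_sub, Matrix.sub_mul, Matrix.mul_one, Matrix.nonsing_inv_mul T hTd]
    rwa [h2, Matrix.det_conj' hT] at h1
  have hne : (1 - H).det ≠ 0 := by
    intro h0
    have := hdet' 0 le_rfl
    rw [h0] at this
    simp [evalAt] at this
    linarith
  exact ⟨hne.isUnit, (InRHinf.one.sub hH).of_inv_det
    (inv_mem_rhInf (InRHinf.one.sub hH).det hc hdet')⟩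

end SmallGain

/-! ### Robust stability and performance of the error loop -/

section Performance

set_option linter.unusedSectionVars false

variable {v q z w : Type*} [Fintype v] [DecidableEq v] [Fintype q] [DecidableEq q]
  [Fintype z] [DecidableEq z] [Fintype w] [DecidableEq w]

theorem scaled_sub_eq_fromBlocks (N₁₁ : Matrix v q ℂ) (N₁₂ : Matrix v w ℂ) (N₂₁ : Matrix z q ℂ)
    (D₁ : Matrix v v ℂ) (D₂ : Matrix q q ℂ) (η : ℝ) :
    (η : ℂ) • diag2 D₁ 1 - fromBlocks N₁₁ N₁₂ N₂₁ 0 * (diag2 D₂ 1 : Matrix (q ⊕ w) (q ⊕ w) ℂ) *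
      (fromBlocks N₁₁ N₁₂ N₂₁ 0)ᴴ =
    fromBlocks ((η : ℂ) • D₁ - N₁₁ * D₂ * N₁₁ᴴ - N₁₂ * N₁₂ᴴ) (-(N₁₁ * D₂ * N₂₁ᴴ))
      (-(N₂₁ * D₂ * N₁₁ᴴ)) ((η : ℂ) • (1 : Matrix z z ℂ) - N₂₁ * D₂ * N₂₁ᴴ) := by
  rw [diag2, diag2, fromBlocks_smul, fromBlocks_conjTranspose, fromBlocks_multiply,
    fromBlocks_multiply, sub_eq_add_neg, fromBlocks_neg, fromBlocks_add]
  simp [sub_eq_add_neg, add_assoc, add_comm]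

/-- Pointwise robust performance with full-information scalings. -/
theorem performance_posSemidef (N₁₁ : Matrix v q ℂ) (N₁₂ : Matrix v w ℂ) (N₂₁ : Matrix z q ℂ)
    {D₁ : Matrix v v ℂ} {D₂ : Matrix q q ℂ} (hD₂ : D₂.PosSemidef) {η γ : ℝ}
    (hη : 0 ≤ η) (hη' : η ≤ 1) (hηγ : η * γ ^ 2 < 1)
    (hN : ((η : ℂ) • diag2 D₁ 1 -
      fromBlocks N₁₁ N₁₂ N₂₁ 0 * (diag2 D₂ 1 : Matrix (q ⊕ w) (q ⊕ w) ℂ) * (fromBlocks N₁₁ N₁₂ N₂₁ 0)ᴴ).PosSemidef)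
    {Δ : Matrix q v ℂ} (hΔ : (((γ ^ 2 : ℝ) : ℂ) • D₂ - Δ * D₁ * Δᴴ).PosSemidef)
    {X : Matrix v v ℂ} (hX : X * (1 - N₁₁ * Δ) = 1) :
    ((1 : Matrix z z ℂ) - ((2 - η * γ ^ 2 : ℝ) : ℂ) •
      (N₂₁ * Δ * X * N₁₂ * (N₂₁ * Δ * X * N₁₂)ᴴ)).PosSemidef := by
  set Q : Matrix z v ℂ := N₂₁ * Δ * X with hQ
  set C : Matrix z q ℂ := Q * N₁₁ + N₂₁ with hC
  -- From $X=I+XN_{11}\Delta$: $Q=N_{21}\Delta+N_{21}\Delta XN_{11}\Delta=(N_{21}+QN_{11})\Delta$.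
  have hQC : Q = C * Δ := by
    have h : X = 1 + X * N₁₁ * Δ := by
      rw [Matrix.mul_sub, Matrix.mul_one, sub_eq_iff_eq_add, ← Matrix.mul_assoc] at hX
      exact hX
    calc Q = N₂₁ * Δ * (1 + X * N₁₁ * Δ) := by rw [← h]
      _ = C * Δ := by
        rw [hC, hQ, Matrix.add_mul, Matrix.mul_add, Matrix.mul_one, add_comm]
        simp only [Matrix.mul_assoc]
  rw [scaled_sub_eq_fromBlocks] at hN
  -- The row $[Q\ \ I]$ gives the usual performance estimate. For $\eta=1$ it alone yields only a
  -- norm at most 1; the row $[Q\ \ 0]$ supplies what makes the bound strict.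
  have h1 := hN.mul_mul_conjTranspose_same (fromCols Q (1 : Matrix z z ℂ))
  have h2 := hN.mul_mul_conjTranspose_same (fromCols Q (0 : Matrix z z ℂ))
  have h3 := hΔ.mul_mul_conjTranspose_same C
  have h4 := hD₂.mul_mul_conjTranspose_same C
  have h5 := hD₂.mul_mul_conjTranspose_same (Q * N₁₁)
  have e1 : fromCols Q (1 : Matrix z z ℂ) *
      fromBlocks ((η : ℂ) • D₁ - N₁₁ * D₂ * N₁₁ᴴ - N₁₂ * N₁₂ᴴ) (-(N₁₁ * D₂ * N₂₁ᴴ))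
        (-(N₂₁ * D₂ * N₁₁ᴴ)) ((η : ℂ) • (1 : Matrix z z ℂ) - N₂₁ * D₂ * N₂₁ᴴ) *
      (fromCols Q (1 : Matrix z z ℂ))ᴴ =
      (η : ℂ) • (Q * D₁ * Qᴴ) + (η : ℂ) • 1 - C * D₂ * Cᴴ - Q * N₁₂ * (Q * N₁₂)ᴴ := by
    rw [fromCols_mul_fromBlocks, conjTranspose_fromCols_eq_fromRows_conjTranspose,
      fromCols_mul_fromRows, hC]
    simp only [Matrix.mul_sub, Matrix.sub_mul, Matrix.mul_add, Matrix.add_mul, Matrix.mul_smul,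
      Matrix.smul_mul, conjTranspose_mul, conjTranspose_add, conjTranspose_one, Matrix.one_mul,
      Matrix.mul_one, Matrix.mul_neg, Matrix.neg_mul, Matrix.mul_assoc]
    abel
  have e2 : fromCols Q (0 : Matrix z z ℂ) *
      fromBlocks ((η : ℂ) • D₁ - N₁₁ * D₂ * N₁₁ᴴ - N₁₂ * N₁₂ᴴ) (-(N₁₁ * D₂ * N₂₁ᴴ))
        (-(N₂₁ * D₂ * N₁₁ᴴ)) ((η : ℂ) • (1 : Matrix z z ℂ) - N₂₁ * D₂ * N₂₁ᴴ) *
      (fromCols Q (0 : Matrix z z ℂ))ᴴ =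
      (η : ℂ) • (Q * D₁ * Qᴴ) - (Q * N₁₁) * D₂ * (Q * N₁₁)ᴴ - Q * N₁₂ * (Q * N₁₂)ᴴ := by
    rw [fromCols_mul_fromBlocks, conjTranspose_fromCols_eq_fromRows_conjTranspose,
      fromCols_mul_fromRows]
    simp only [Matrix.mul_sub, Matrix.sub_mul, Matrix.mul_smul, add_zero,
      Matrix.smul_mul, conjTranspose_mul, conjTranspose_zero, Matrix.zero_mul,
      Matrix.mul_zero, Matrix.mul_assoc]
  have e3 : C * (((γ ^ 2 : ℝ) : ℂ) • D₂ - Δ * D₁ * Δᴴ) * Cᴴ =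
      ((γ ^ 2 : ℝ) : ℂ) • (C * D₂ * Cᴴ) - Q * D₁ * Qᴴ := by
    rw [hQC]
    simp only [Matrix.mul_sub, Matrix.sub_mul, Matrix.mul_smul, Matrix.smul_mul,
      conjTranspose_mul, Matrix.mul_assoc]
  rw [e1] at h1
  rw [e2] at h2
  rw [e3] at h3
  have hμ : (0 : ℂ) ≤ ((1 - η * γ ^ 2 : ℝ) : ℂ) := by
    rw [Complex.zero_le_real]; linarith
  have hμ' : (0 : ℂ) ≤ ((1 - η : ℝ) : ℂ) := by
    rw [Complex.zero_le_real]; linarith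
  have h3' := h3.smul (show (0 : ℂ) ≤ (η : ℂ) by rwa [Complex.zero_le_real])
  -- With $\Pi=QN_{12}(QN_{12})^H$ this says $\Pi\preceq CD_2C^H$.
  have h6 := ((h2.add h5).add h3').add (h4.smul hμ)
  -- With $\mu=1-\eta\gamma^2$, `h1` and `h3'` give $\Pi\preceq\eta I-\mu CD_2C^H$. Adding $\mu$
  -- times `h6` cancels $CD_2C^H$ and leaves $(1+\mu)\Pi\preceq\eta I\preceq I$, where
  -- $1+\mu=2-\eta\gamma^2$.
  have h7 := ((h1.add h3').add (h6.smul hμ)).add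
    ((Matrix.PosSemidef.one : (1 : Matrix z z ℂ).PosSemidef).smul hμ')
  convert h7 using 1
  push_cast
  module

theorem matSpectralNorm_le_of_posSemidef {B : Matrix z w ℂ} {κ : ℝ} (hκ : 0 < κ)
    (h : ((1 : Matrix z z ℂ) - (κ : ℂ) • (B * Bᴴ)).PosSemidef) :
    matSpectralNorm B ≤ √(κ⁻¹) := by
  refine norm_le_of_posSemidef (Real.sqrt_nonneg _) ?_
  rw [Real.sq_sqrt (by positivity)]
  have := h.smul (show (0 : ℂ) ≤ ((κ⁻¹ : ℝ) : ℂ) by rw [Complex.zero_le_real]; positivity)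
  convert this using 1
  rw [smul_sub, smul_smul]
  congr 1
  rw [← Complex.ofReal_mul, inv_mul_cancel₀ hκ.ne', Complex.ofReal_one, one_smul]

theorem ScaledBound.mono {N : Matrix z w (RatFunc ℂ)} {D : Matrix z z ℂ × Matrix w w ℂ}
    (hD : D.1.PosSemidef) {η η' : ℝ} (hη : η ≤ η') (h : ScaledBound N D η) :
    ScaledBound N D η' := by
  intro ω
  have := (h ω).add (hD.smul (show (0 : ℂ) ≤ ((η' - η : ℝ) : ℂ) by
    rw [Complex.zero_le_real]; linarith))
  convert this using 1
  push_cast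
  module

theorem freqResp_fromBlocks (A : Matrix v q (RatFunc ℂ)) (B : Matrix v w (RatFunc ℂ))
    (C : Matrix z q (RatFunc ℂ)) (D : Matrix z w (RatFunc ℂ)) (ω : ℝ) :
    freqResp (fromBlocks A B C D) ω =
      fromBlocks (freqResp A ω) (freqResp B ω) (freqResp C ω) (freqResp D ω) :=
  fromBlocks_map _ _ _ _ _

theorem freqResp_zero (ω : ℝ) : freqResp (0 : Matrix v q (RatFunc ℂ)) ω = 0 :=
  Matrix.map_zero _ (RatFunc.eval_zero _ _)

/-- Robust stability and robust performance for an upper feedback interconnection. -/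
theorem robust_performance {N₁₁ : Matrix v q (RatFunc ℂ)} {N₁₂ : Matrix v w (RatFunc ℂ)}
    {N₂₁ : Matrix z q (RatFunc ℂ)} {Δ : Matrix q v (RatFunc ℂ)}
    (h₁₁ : InRHinf N₁₁) (h₁₂ : InRHinf N₁₂) (h₂₁ : InRHinf N₂₁) (hΔ : InRHinf Δ)
    {D₁ : Matrix v v ℂ} {D₂ : Matrix q q ℂ} (hD₁ : D₁.PosDef) (hD₂ : D₂.PosSemidef) {η γ : ℝ}
    (hη : 0 ≤ η) (hη' : η ≤ 1) (hηγ : η * γ ^ 2 < 1)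
    (hN : ScaledBound (fromBlocks N₁₁ N₁₂ N₂₁ 0) (diag2 D₁ 1, diag2 D₂ 1) η)
    (hΔD : ∀ ω, (((γ ^ 2 : ℝ) : ℂ) • D₂ - freqResp Δ ω * D₁ * (freqResp Δ ω)ᴴ).PosSemidef) :
    IsUnit (1 - N₁₁ * Δ).det ∧ InRHinf (1 - N₁₁ * Δ)⁻¹ ∧
      hinfNorm (N₂₁ * Δ * (1 - N₁₁ * Δ)⁻¹ * N₁₂) < 1 := by
  have hH := h₁₁.mul hΔ
  have hγ : (0 : ℂ) ≤ ((γ ^ 2 : ℝ) : ℂ) := by rw [Complex.zero_le_real]; positivity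
  have key : IsUnit (1 - N₁₁ * Δ).det ∧ InRHinf (1 - N₁₁ * Δ)⁻¹ := by
    refine small_gain hH hD₁ (θ := η * γ ^ 2) (by positivity) hηγ fun ω => ?_
    have e1 := hN ω
    rw [freqResp_fromBlocks, freqResp_zero, scaled_sub_eq_fromBlocks] at e1
    have h1 : ((η : ℂ) • D₁ - freqResp N₁₁ ω * D₂ * (freqResp N₁₁ ω)ᴴ -
        freqResp N₁₂ ω * (freqResp N₁₂ ω)ᴴ).PosSemidef := e1.submatrix Sum.inl
    -- $N_{11}\Delta D_1\Delta^HN_{11}^H\preceq\gamma^2N_{11}D_2N_{11}^H\preceq\eta\gamma^2D_1$, the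
    -- last step after discarding $N_{12}N_{12}^H\succeq0$.
    have h2 := (hΔD ω).mul_mul_conjTranspose_same (freqResp N₁₁ ω)
    have h3 := h1.add (posSemidef_self_mul_conjTranspose (freqResp N₁₂ ω))
    have h4 := h2.add (h3.smul hγ)
    have e2 : freqResp (N₁₁ * Δ) ω = freqResp N₁₁ ω * freqResp Δ ω :=
      evalMat_mul (I_mul_re_nonneg ω) h₁₁ hΔ
    convert h4 using 1
    rw [e2]
    simp only [Matrix.mul_sub, Matrix.sub_mul, Matrix.mul_smul, Matrix.smul_mul,
      conjTranspose_mul, Matrix.mul_assoc]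
    push_cast
    module
  refine ⟨key.1, key.2, ?_⟩
  set X := (1 - N₁₁ * Δ)⁻¹ with hX
  have hXinv : X * (1 - N₁₁ * Δ) = 1 := Matrix.nonsing_inv_mul _ key.1
  have hκ : 1 < 2 - η * γ ^ 2 := by linarith
  -- The bound does not depend on the frequency, so the supremum also stays strictly below 1.
  have hsup : hinfNorm (N₂₁ * Δ * X * N₁₂) ≤ ENNReal.ofReal (√((2 - η * γ ^ 2)⁻¹)) := by
    refine iSup_le fun ω => ENNReal.ofReal_le_ofReal ?_
    refine matSpectralNorm_le_of_posSemidef (by linarith) ?_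
    have hs := I_mul_re_nonneg ω
    have e1 : freqResp (N₂₁ * Δ * X * N₁₂) ω =
        freqResp N₂₁ ω * freqResp Δ ω * freqResp X ω * freqResp N₁₂ ω := by
      simp only [freqResp_eq_evalMat]
      rw [evalMat_mul hs ((h₂₁.mul hΔ).mul key.2) h₁₂, evalMat_mul hs (h₂₁.mul hΔ) key.2,
        evalMat_mul hs h₂₁ hΔ]
    have e2 : freqResp X ω * (1 - freqResp N₁₁ ω * freqResp Δ ω) = 1 := by
      have := congrArg (evalMat (Complex.I * ω)) hXinv
      rw [evalMat_mul hs key.2 (InRHinf.one.sub hH), evalMat_one_sub hs hH,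
        evalMat_mul hs h₁₁ hΔ] at this
      rw [freqResp_eq_evalMat, freqResp_eq_evalMat, freqResp_eq_evalMat, this]
      exact Matrix.map_one _ (RatFunc.eval_zero _ _) (RatFunc.eval_one _ _)
    have e3 := hN ω
    rw [freqResp_fromBlocks, freqResp_zero] at e3
    rw [e1]
    exact performance_posSemidef _ _ _ hD₂ hη hη' hηγ e3 (hΔD ω) e2
  refine hsup.trans_lt ?_
  rw [ENNReal.ofReal_lt_one, Real.sqrt_lt' one_pos, one_pow]
  exact inv_lt_one_of_one_lt₀ hκ

end Performance

/-! ### Removing the weights -/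

section Weights

set_option linter.unusedSectionVars false

variable {v q z w : Type*} [Fintype v] [DecidableEq v] [Fintype q] [DecidableEq q]
  [Fintype z] [DecidableEq z] [Fintype w] [DecidableEq w]

theorem diag2_mul_diag2 {R a b c d e f : Type*} [NonUnitalNonAssocSemiring R] [Fintype b]
    [Fintype e] (A : Matrix a b R) (B : Matrix b c R) (A' : Matrix d e R) (B' : Matrix e f R) :
    diag2 A A' * diag2 B B' = diag2 (A * B) (A' * B') := by
  simp [diag2, fromBlocks_multiply]

theorem isUnit_det_diag2 {R : Type*} [CommRing R] {A : Matrix v v R} {B : Matrix z z R}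
    (h : IsUnit (diag2 A B).det) : IsUnit A.det ∧ IsUnit B.det := by
  rw [diag2, det_fromBlocks_zero₂₁] at h
  exact IsUnit.mul_iff.mp h

theorem inv_diag2 {R : Type*} [CommRing R] {A : Matrix v v R} {B : Matrix z z R}
    (hA : IsUnit A.det) (hB : IsUnit B.det) : (diag2 A B)⁻¹ = diag2 A⁻¹ B⁻¹ := by
  apply Matrix.inv_eq_right_inv
  rw [diag2_mul_diag2, Matrix.mul_nonsing_inv _ hA, Matrix.mul_nonsing_inv _ hB, diag2,
    fromBlocks_one]

theorem IsBistableBiproper.of_diag2 {A : Matrix v v (RatFunc ℂ)} {B : Matrix z z (RatFunc ℂ)}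
    (h : IsBistableBiproper (diag2 A B)) : IsBistableBiproper A ∧ IsBistableBiproper B := by
  obtain ⟨h1, h2, h3⟩ := h
  obtain ⟨hA, hB⟩ := isUnit_det_diag2 h2
  rw [inv_diag2 hA hB] at h3
  exact ⟨⟨h1.submatrix Sum.inl Sum.inl, hA, h3.submatrix Sum.inl Sum.inl⟩,
    ⟨h1.submatrix Sum.inr Sum.inr, hB, h3.submatrix Sum.inr Sum.inr⟩⟩

/-- Robust performance with weights. -/
theorem robust_performance_weighted
    {N₁₁ : Matrix v q (RatFunc ℂ)} {N₁₂ : Matrix v w (RatFunc ℂ)}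
    {N₂₁ : Matrix z q (RatFunc ℂ)} {Δ : Matrix q v (RatFunc ℂ)}
    {V : Matrix v v (RatFunc ℂ)} {VC : Matrix z z (RatFunc ℂ)}
    {W : Matrix q q (RatFunc ℂ)} {WC : Matrix w w (RatFunc ℂ)}
    (hV : IsBistableBiproper (diag2 V VC)) (hW : IsBistableBiproper (diag2 W WC))
    (h₁₁ : InRHinf N₁₁) (h₁₂ : InRHinf N₁₂) (h₂₁ : InRHinf N₂₁) (hΔ : InRHinf Δ)
    {D₁ : Matrix v v ℂ} {D₂ : Matrix q q ℂ} (hD₁ : D₁.PosDef) (hD₂ : D₂.PosSemidef) {η γ : ℝ}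
    (hη : 0 ≤ η) (hη' : η ≤ 1) (hηγ : η * γ ^ 2 < 1)
    (hN : ScaledBound (diag2 V VC * fromBlocks N₁₁ N₁₂ N₂₁ 0 * diag2 W WC)
      (diag2 D₁ 1, diag2 D₂ 1) η)
    (hΔD : ∀ ω, (((γ ^ 2 : ℝ) : ℂ) • D₂ -
      freqResp (W⁻¹ * Δ * V⁻¹) ω * D₁ * (freqResp (W⁻¹ * Δ * V⁻¹) ω)ᴴ).PosSemidef) :
    ∃ X : Matrix v v (RatFunc ℂ), InRHinf X ∧ (1 - N₁₁ * Δ) * X = 1 ∧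
      hinfNorm (VC * (N₂₁ * Δ * X * N₁₂) * WC) < 1 := by
  obtain ⟨⟨hV1, hV2, hV3⟩, hVC, -⟩ := hV.of_diag2
  obtain ⟨⟨hW1, hW2, hW3⟩, hWC, -⟩ := hW.of_diag2
  have e : diag2 V VC * fromBlocks N₁₁ N₁₂ N₂₁ 0 * diag2 W WC =
      fromBlocks (V * N₁₁ * W) (V * N₁₂ * WC) (VC * N₂₁ * W) 0 := by
    simp [diag2, fromBlocks_multiply]
  rw [e] at hN
  obtain ⟨hu, hX, hn⟩ := robust_performance ((hV1.mul h₁₁).mul hW1) ((hV1.mul h₁₂).mul hWC)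
    ((hVC.mul h₂₁).mul hW1) ((hW3.mul hΔ).mul hV3) hD₁ hD₂ hη hη' hηγ hN hΔD
  set Δ' := W⁻¹ * Δ * V⁻¹ with hΔ'
  set X := (1 - V * N₁₁ * W * Δ')⁻¹ with hXdef
  have hWΔ : W * Δ' = Δ * V⁻¹ := by
    rw [hΔ', Matrix.mul_assoc, ← Matrix.mul_assoc W, Matrix.mul_nonsing_inv _ hW2,
      Matrix.one_mul]
  have hVV : V⁻¹ * V = 1 := Matrix.nonsing_inv_mul _ hV2
  have hXi : (1 - V * N₁₁ * W * Δ') * X = 1 := Matrix.mul_nonsing_inv _ hu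
  -- The weighted loop gain is $VN_{11}W\Delta'=V(N_{11}\Delta)V^{-1}$, so the two inverses are
  -- conjugate by $V$, which is bistable.
  refine ⟨V⁻¹ * X * V, (hV3.mul hX).mul hV1, ?_, ?_⟩
  · have h1 : (1 - N₁₁ * Δ) * V⁻¹ = V⁻¹ * (1 - V * N₁₁ * W * Δ') := by
      rw [Matrix.sub_mul, Matrix.mul_sub, Matrix.one_mul, Matrix.mul_one]
      congr 1
      rw [Matrix.mul_assoc _ W, hWΔ]
      simp only [← Matrix.mul_assoc]
      rw [hVV, Matrix.one_mul]
    calc (1 - N₁₁ * Δ) * (V⁻¹ * X * V) = (1 - N₁₁ * Δ) * V⁻¹ * X * V := by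
          simp only [Matrix.mul_assoc]
      _ = V⁻¹ * ((1 - V * N₁₁ * W * Δ') * X) * V := by rw [h1]; simp only [Matrix.mul_assoc]
      _ = 1 := by rw [hXi, Matrix.mul_one, hVV]
  · convert hn using 2
    calc VC * (N₂₁ * Δ * (V⁻¹ * X * V) * N₁₂) * WC
        = VC * N₂₁ * (Δ * V⁻¹) * X * (V * N₁₂ * WC) := by simp only [Matrix.mul_assoc]
      _ = _ := by rw [← hWΔ]; simp only [Matrix.mul_assoc]

end Weights

/-! ### The error loop reproduces the reduced interconnection -/

section Interconnection

set_option linter.unusedSectionVars false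

variable {u y α β z w : Type*} [Fintype u] [DecidableEq u] [Fintype y] [DecidableEq y]
  [Fintype α] [DecidableEq α] [Fintype β] [DecidableEq β]

/-- The channel part of the system relating low-level errors and the interconnected error. -/
def netN (M : Matrix y u (RatFunc ℂ)) (Y : Matrix u y (RatFunc ℂ)) (E12 : Matrix u β (RatFunc ℂ))
    (E21 : Matrix α y (RatFunc ℂ)) (E22 : Matrix α β (RatFunc ℂ)) :
    Matrix (α ⊕ (u ⊕ α)) (β ⊕ (y ⊕ β)) (RatFunc ℂ) :=
  block33
    (E22 - E21 * M * E12)   (E21 * (1 + M * Y)) (E21 * M * E12)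
    (-(Y * M * E12) - E12)  (Y * (1 + M * Y))   (Y * M * E12)
    (-(E21 * M * E12))      (E21 * M * Y)       (E22 + E21 * M * E12)

/-- The input part of the system relating low-level errors and the interconnected error. -/
def netIn (M : Matrix y u (RatFunc ℂ)) (Y : Matrix u y (RatFunc ℂ))
    (E21 : Matrix α y (RatFunc ℂ)) : Matrix (α ⊕ (u ⊕ α)) u (RatFunc ℂ) :=
  fromRows (E21 * M) (fromRows (1 + Y * M) (E21 * M))

/-- The output part of the system relating low-level errors and the interconnected error. -/
def netOut (M : Matrix y u (RatFunc ℂ)) (Y : Matrix u y (RatFunc ℂ))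
    (E12 : Matrix u β (RatFunc ℂ)) : Matrix y (β ⊕ (y ⊕ β)) (RatFunc ℂ) :=
  fromCols (-(M * E12)) (fromCols (1 + M * Y) (M * E12))

theorem fromRows_add_fromRows {R a b c : Type*} [Add R] (A A' : Matrix a c R)
    (B B' : Matrix b c R) : fromRows A B + fromRows A' B' = fromRows (A + A') (B + B') := by
  ext (i | i) j <;> rfl

/-- If `M` is the closed-loop map from disturbances to subsystem outputs, then so is `M̂` for
the perturbed subsystems, where `M̂` solves the loop closed by the abstraction error `R` and the
reduction error `F`. -/
theorem closedLoop_of_error {S22 Ebar R : Matrix u y (RatFunc ℂ)}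
    {Sg Sh T T' M M' qF : Matrix y u (RatFunc ℂ)}
    (hM : M = Sg * (1 + S22 * M))
    (hT : T - T * (Ebar + R) * Sg = Sg) (hT' : T' = Sh + Sh * (Ebar + R) * T')
    (hqF : qF = (T' - T) * (1 + (S22 - Ebar) * M' - R * M'))
    (hM' : M' = M + qF + M * (S22 - Ebar) * qF - M * R * qF) :
    M' = Sh * (1 + S22 * M') := by
  -- $Z$ is the part of the coupling $S_{22}$ missed by the abstracted environments $\bar E+R$.
  set Z := S22 - Ebar - R with hZ
  have hS : S22 = Ebar + R + Z := by rw [hZ]; abel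
  -- Close the loop in two stages: first through $\bar E+R$, which turns $\Sigma_B$ into $T$, then
  -- through $Z$. Here $I+T(\bar E+R)$ inverts $I-\Sigma_B(\bar E+R)$.
  have h1 : M = T * (1 + Z * M) := by
    have e1 : M - Sg * (Ebar + R) * M = Sg * (1 + Z * M) := by
      rw [sub_eq_iff_eq_add]
      conv_lhs => rw [hM, hS]
      simp only [Matrix.mul_add, Matrix.add_mul, Matrix.mul_assoc, Matrix.mul_one]
      abel
    have e2 : (1 + T * (Ebar + R)) * (M - Sg * (Ebar + R) * M) = M := by
      calc (1 + T * (Ebar + R)) * (M - Sg * (Ebar + R) * M)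
          = M + (T - T * (Ebar + R) * Sg) * ((Ebar + R) * M) - Sg * ((Ebar + R) * M) := by
            simp only [Matrix.mul_add, Matrix.add_mul, Matrix.mul_assoc, Matrix.one_mul,
              Matrix.mul_sub, Matrix.sub_mul]
            abel
        _ = M := by rw [hT]; abel
    have e3 : (1 + T * (Ebar + R)) * Sg = T := by
      rw [Matrix.add_mul, Matrix.one_mul]
      nth_rewrite 1 [← hT]
      abel
    conv_lhs => rw [← e2, e1, ← Matrix.mul_assoc, e3]
  have hqF' : qF = (T' - T) * (1 + Z * M') := by
    rw [hqF, hZ]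
    congr 1
    rw [Matrix.sub_mul _ R, add_sub_assoc]
  have hM'' : M' = M + (1 + M * Z) * qF := by
    rw [hM', hZ]
    simp only [Matrix.mul_sub, Matrix.add_mul, Matrix.sub_mul, Matrix.one_mul]
    abel
  have h2 : (1 - T * Z) * M = T := by
    rw [Matrix.sub_mul, Matrix.one_mul, sub_eq_iff_eq_add]
    conv_lhs => rw [h1]
    rw [Matrix.mul_add, Matrix.mul_one, Matrix.mul_assoc]
  -- Since $(I-TZ)M=T$, applying $I-TZ$ to $M'=M+(I+MZ)q_F$ leaves $T+q_F$; inserting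
  -- $q_F=(T'-T)(I+ZM')$ replaces $T$ by $T'$.
  have h3 : M' = T' * (1 + Z * M') := by
    have e1 : (1 - T * Z) * M' = T + qF := by
      rw [hM'', Matrix.mul_add, h2, ← Matrix.mul_assoc, Matrix.mul_add, ← Matrix.mul_assoc, h2]
      congr 1
      rw [Matrix.mul_one, sub_add_cancel, Matrix.one_mul]
    rw [hqF', Matrix.sub_mul, Matrix.one_mul, sub_eq_iff_eq_add] at e1
    rw [e1]
    conv_rhs => rw [← e1]
    simp only [Matrix.mul_add, Matrix.sub_mul, Matrix.mul_assoc, Matrix.mul_one]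
    abel
  -- The two-stage decomposition is now undone for the reduced subsystems.
  have h4 : M' - Sh * (Ebar + R) * M' = Sh * (1 + Z * M') := by
    rw [sub_eq_iff_eq_add]
    calc M' = T' * (1 + Z * M') := h3
      _ = (Sh + Sh * (Ebar + R) * T') * (1 + Z * M') := by rw [← hT']
      _ = Sh * (1 + Z * M') + Sh * (Ebar + R) * (T' * (1 + Z * M')) := by
        rw [Matrix.add_mul, Matrix.mul_assoc _ T']
      _ = Sh * (1 + Z * M') + Sh * (Ebar + R) * M' := by rw [← h3]
  rw [sub_eq_iff_eq_add] at h4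
  rw [hS]
  conv_lhs => rw [h4]
  simp only [Matrix.mul_add, Matrix.add_mul, Matrix.mul_assoc, Matrix.mul_one]
  abel

/-- The loop closed by the low-level errors produces the perturbed closed-loop map. -/
theorem perturbed_closedLoop {S22 Ebar R : Matrix u y (RatFunc ℂ)}
    {Sg Sh T T' M : Matrix y u (RatFunc ℂ)}
    {E12 : Matrix u β (RatFunc ℂ)} {E21 : Matrix α y (RatFunc ℂ)} {E22 : Matrix α β (RatFunc ℂ)}
    {A : Matrix β α (RatFunc ℂ)} {X : Matrix (α ⊕ (u ⊕ α)) (α ⊕ (u ⊕ α)) (RatFunc ℂ)}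
    (hM : M = Sg * (1 + S22 * M))
    (hT : T - T * (Ebar + R) * Sg = Sg) (hT' : T' = Sh + Sh * (Ebar + R) * T')
    (hR : ∀ (x : Matrix y u (RatFunc ℂ)) (q : Matrix β u (RatFunc ℂ)),
      q = A * (E21 * x + E22 * q) → E12 * q = R * x)
    (hX : (1 - netN M (S22 - Ebar) E12 E21 E22 * diag2 A (diag2 (T' - T) A)) * X = 1)
    {M' : Matrix y u (RatFunc ℂ)}
    (hM' : M' = M + netOut M (S22 - Ebar) E12 * diag2 A (diag2 (T' - T) A) * X *
      netIn M (S22 - Ebar) E21) :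
    M' = Sh * (1 + S22 * M') := by
  set Y := S22 - Ebar with hY
  set Δ := diag2 A (diag2 (T' - T) A) with hΔ
  set v := X * netIn M Y E21 with hv
  -- $v$ stacks the signals entering the three error blocks for a unit disturbance at the subsystem
  -- inputs, and $\Delta v$ their outputs.
  have hv1 : v = netIn M Y E21 + netN M Y E12 E21 E22 * (Δ * v) := by
    have h := congrArg (· * netIn M Y E21) hX
    simp only [Matrix.one_mul] at h
    rw [Matrix.mul_assoc, ← hv, Matrix.sub_mul, Matrix.one_mul, sub_eq_iff_eq_add] at h
    rw [← Matrix.mul_assoc]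
    exact h
  obtain ⟨vA, vr, hvv⟩ : ∃ vA vr, v = fromRows vA vr := ⟨_, _, (fromRows_toRows v).symm⟩
  obtain ⟨vF, vC, rfl⟩ : ∃ vF vC, vr = fromRows vF vC := ⟨_, _, (fromRows_toRows vr).symm⟩
  have hq : Δ * v = fromRows (A * vA) (fromRows ((T' - T) * vF) (A * vC)) := by
    rw [hΔ, hvv, diag2, diag2, fromBlocks_mul_fromRows, fromBlocks_mul_fromRows]
    simp
  have hM1 : M' = M - M * E12 * (A * vA) + (1 + M * Y) * ((T' - T) * vF) +
      M * E12 * (A * vC) := by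
    rw [hM', Matrix.mul_assoc, ← hv, Matrix.mul_assoc, hq, netOut, fromCols_mul_fromRows,
      fromCols_mul_fromRows, Matrix.neg_mul]
    abel
  rw [hq, hvv, netIn, netN, block33, fromRows_mul, fromRows_mul, fromCols_mul_fromRows,
    fromCols_mul_fromRows, fromCols_mul_fromRows, fromCols_mul_fromRows, fromCols_mul_fromRows,
    fromCols_mul_fromRows, fromRows_add_fromRows, fromRows_add_fromRows] at hv1
  obtain ⟨hA, hv2⟩ := fromRows_inj hv1
  obtain ⟨hF, hC⟩ := fromRows_inj hv2
  set qF := (T' - T) * vF with hqF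
  -- The first copy of $A$ is driven by $M'$; in `hC'` the third block is driven by $M'-q_F$. Hence
  -- `hR` turns their outputs into $RM'$ and $R(M'-q_F)$, and the difference leaves the correction
  -- $-MRq_F$.
  have hA' : vA = E21 * M' + E22 * (A * vA) := by
    conv_lhs => rw [hA]
    rw [hM1]
    simp only [Matrix.mul_add, Matrix.add_mul, Matrix.mul_assoc, Matrix.mul_one, Matrix.mul_sub,
      Matrix.sub_mul, Matrix.one_mul]
    abel
  have hC' : vC = E21 * (M' - qF) + E22 * (A * vC) := by
    conv_lhs => rw [hC]
    rw [hM1]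
    simp only [Matrix.mul_add, Matrix.add_mul, Matrix.mul_assoc, Matrix.mul_sub,
      Matrix.neg_mul, Matrix.one_mul]
    abel
  have hF' : vF = 1 + Y * M' - E12 * (A * vA) := by
    conv_lhs => rw [hF]
    rw [hM1]
    simp only [Matrix.mul_add, Matrix.add_mul, Matrix.mul_assoc, Matrix.mul_one, Matrix.mul_sub,
      Matrix.sub_mul, Matrix.neg_mul, Matrix.one_mul]
    abel
  have hRA : E12 * (A * vA) = R * M' := hR _ _ (by rw [← hA'])
  have hRC : E12 * (A * vC) = R * (M' - qF) := hR _ _ (by rw [← hC'])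
  rw [hRA] at hF'
  refine closedLoop_of_error hM hT hT' (qF := qF) (by rw [hqF, hF']) ?_
  conv_lhs => rw [hM1]
  rw [Matrix.mul_assoc M E12, Matrix.mul_assoc M E12, hRA, hRC, ← hY]
  simp only [Matrix.add_mul, Matrix.mul_assoc, Matrix.mul_sub, Matrix.one_mul]
  abel

end Interconnection

/-! ### Stability of the interconnection and the common theorem for both abstractions -/

section Stability

set_option linter.unusedSectionVars false

variable {u y α β z w : Type*} [Fintype u] [DecidableEq u] [Fintype y] [DecidableEq y]
  [Fintype α] [DecidableEq α] [Fintype β] [DecidableEq β]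

theorem InRHinf.block33 {a₁ a₂ a₃ b₁ b₂ b₃ : Type*}
    {A₁₁ : Matrix a₁ b₁ (RatFunc ℂ)} {A₁₂ : Matrix a₁ b₂ (RatFunc ℂ)}
    {A₁₃ : Matrix a₁ b₃ (RatFunc ℂ)} {A₂₁ : Matrix a₂ b₁ (RatFunc ℂ)}
    {A₂₂ : Matrix a₂ b₂ (RatFunc ℂ)} {A₂₃ : Matrix a₂ b₃ (RatFunc ℂ)}
    {A₃₁ : Matrix a₃ b₁ (RatFunc ℂ)} {A₃₂ : Matrix a₃ b₂ (RatFunc ℂ)}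
    {A₃₃ : Matrix a₃ b₃ (RatFunc ℂ)}
    (h₁₁ : InRHinf A₁₁) (h₁₂ : InRHinf A₁₂) (h₁₃ : InRHinf A₁₃) (h₂₁ : InRHinf A₂₁)
    (h₂₂ : InRHinf A₂₂) (h₂₃ : InRHinf A₂₃) (h₃₁ : InRHinf A₃₁) (h₃₂ : InRHinf A₃₂)
    (h₃₃ : InRHinf A₃₃) : InRHinf (block33 A₁₁ A₁₂ A₁₃ A₂₁ A₂₂ A₂₃ A₃₁ A₃₂ A₃₃) :=
  (h₁₁.fromCols (h₁₂.fromCols h₁₃)).fromRows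
    ((h₂₁.fromCols (h₂₂.fromCols h₂₃)).fromRows (h₃₁.fromCols (h₃₂.fromCols h₃₃)))

section

variable {M : Matrix y u (RatFunc ℂ)} {Y : Matrix u y (RatFunc ℂ)} {E12 : Matrix u β (RatFunc ℂ)}
  {E21 : Matrix α y (RatFunc ℂ)} {E22 : Matrix α β (RatFunc ℂ)}

theorem InRHinf.netN (hM : InRHinf M) (hY : InRHinf Y) (h12 : InRHinf E12) (h21 : InRHinf E21)
    (h22 : InRHinf E22) : InRHinf (netN M Y E12 E21 E22) :=
  InRHinf.block33 (h22.sub ((h21.mul hM).mul h12)) (h21.mul (one.add (hM.mul hY)))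
    ((h21.mul hM).mul h12) (((hY.mul hM).mul h12).neg.sub h12) (hY.mul (one.add (hM.mul hY)))
    ((hY.mul hM).mul h12) ((h21.mul hM).mul h12).neg ((h21.mul hM).mul hY)
    (h22.add ((h21.mul hM).mul h12))

theorem InRHinf.netIn (hM : InRHinf M) (hY : InRHinf Y) (h21 : InRHinf E21) :
    InRHinf (netIn M Y E21) :=
  (h21.mul hM).fromRows ((one.add (hY.mul hM)).fromRows (h21.mul hM))

theorem InRHinf.netOut (hM : InRHinf M) (hY : InRHinf Y) (h12 : InRHinf E12) :
    InRHinf (netOut M Y E12) :=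
  (hM.mul h12).neg.fromCols ((one.add (hM.mul hY)).fromCols (hM.mul h12))

end

variable {S : Matrix (z ⊕ u) (w ⊕ y) (RatFunc ℂ)}

/-- The two expressions for the closed-loop map from disturbances at the subsystem inputs to the
subsystem outputs agree. -/
theorem closedLoop_eq {Sg : Matrix y u (RatFunc ℂ)} (h : WellPosed S Sg) :
    (1 - Sg * S.toBlocks₂₂)⁻¹ * Sg = Sg * (1 - S.toBlocks₂₂ * Sg)⁻¹ := by
  have hu := h.1
  have hu' : IsUnit (1 - Sg * S.toBlocks₂₂).det := by rwa [det_one_sub_mul_comm]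
  have h1 : Sg * (1 - S.toBlocks₂₂ * Sg) = (1 - Sg * S.toBlocks₂₂) * Sg := by
    simp only [Matrix.mul_sub, Matrix.sub_mul, Matrix.one_mul, Matrix.mul_one, Matrix.mul_assoc]
  calc (1 - Sg * S.toBlocks₂₂)⁻¹ * Sg
      = (1 - Sg * S.toBlocks₂₂)⁻¹ * (Sg * (1 - S.toBlocks₂₂ * Sg)) *
          (1 - S.toBlocks₂₂ * Sg)⁻¹ := by
        rw [Matrix.mul_assoc, Matrix.mul_assoc, Matrix.mul_nonsing_inv _ hu, Matrix.mul_one]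
    _ = _ := by
        rw [h1, ← Matrix.mul_assoc, Matrix.nonsing_inv_mul _ hu', Matrix.one_mul]

theorem closedLoop_fixed {Sg : Matrix y u (RatFunc ℂ)} (h : WellPosed S Sg) :
    Sg * (1 - S.toBlocks₂₂ * Sg)⁻¹ =
      Sg * (1 + S.toBlocks₂₂ * (Sg * (1 - S.toBlocks₂₂ * Sg)⁻¹)) := by
  congr 1
  have h1 := Matrix.mul_nonsing_inv _ h.1
  rw [Matrix.sub_mul, Matrix.one_mul, sub_eq_iff_eq_add, Matrix.mul_assoc] at h1
  exact h1

/-- A loop with stable `S` and stable closed-loop map is well-posed and internally stable. -/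
theorem wellPosed_of_closedLoop (hS : InRHinf S) {Sh M : Matrix y u (RatFunc ℂ)}
    (hM : InRHinf M) (h : M = Sh * (1 + S.toBlocks₂₂ * M)) :
    WellPosed S Sh ∧ InternallyStable S Sh ∧
      lowerLFT S Sh = S.toBlocks₁₂ * M * S.toBlocks₂₁ + S.toBlocks₁₁ := by
  have h11 : InRHinf S.toBlocks₁₁ := hS.submatrix Sum.inl Sum.inl
  have h12 : InRHinf S.toBlocks₁₂ := hS.submatrix Sum.inl Sum.inr
  have h21 : InRHinf S.toBlocks₂₁ := hS.submatrix Sum.inr Sum.inl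
  have h22 : InRHinf S.toBlocks₂₂ := hS.submatrix Sum.inr Sum.inr
  -- The fixed-point equation exhibits $I+S_{22}M$ as an explicit inverse, so stability of $M$ and
  -- $S$ suffices even if `Sh` itself is unstable.
  have hinv : (1 - S.toBlocks₂₂ * Sh) * (1 + S.toBlocks₂₂ * M) = 1 := by
    rw [Matrix.sub_mul, Matrix.one_mul, Matrix.mul_assoc, ← h, add_sub_cancel_right]
  have hQ : (1 - S.toBlocks₂₂ * Sh)⁻¹ = 1 + S.toBlocks₂₂ * M := Matrix.inv_eq_right_inv hinv
  have hQs : InRHinf (1 - S.toBlocks₂₂ * Sh)⁻¹ := by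
    rw [hQ]
    exact InRHinf.one.add (h22.mul hM)
  have hKQ : Sh * (1 - S.toBlocks₂₂ * Sh)⁻¹ = M := by rw [hQ, ← h]
  have hLFT : lowerLFT S Sh = S.toBlocks₁₂ * M * S.toBlocks₂₁ + S.toBlocks₁₁ := by
    rw [lowerLFT, Matrix.mul_assoc _ Sh, hKQ]
  refine ⟨⟨Matrix.isUnit_det_of_right_inverse hinv, hQs.isTransfer⟩, ?_, hLFT⟩
  have hfin := InRHinf.one.add (hM.mul h22)
  refine ⟨hQs.mul h21, hQs, hQs.mul h22, ?_, ?_, ?_, ?_, ?_, ?_⟩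
  · rw [hKQ]; exact hM.mul h21
  · rw [hKQ]; exact hM
  · rw [hKQ]; exact hfin
  · rw [hLFT]; exact ((h12.mul hM).mul h21).add h11
  · rw [Matrix.mul_assoc, hKQ]; exact h12.mul hM
  · rw [hKQ]; exact h12.mul hfin

variable [Fintype z] [DecidableEq z] [Fintype w] [DecidableEq w]

/-- Top-down robust performance for an interconnection whose low-level errors act through the
channels `E12`, `E21`, `E22`. -/
theorem interconnection_performance {Sg Sh T T' : Matrix y u (RatFunc ℂ)}
    (hS : InRHinf S) (hwp : WellPosed S Sg) (hst : InternallyStable S Sg)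
    {Ebar R : Matrix u y (RatFunc ℂ)} {E12 : Matrix u β (RatFunc ℂ)}
    {E21 : Matrix α y (RatFunc ℂ)} {E22 : Matrix α β (RatFunc ℂ)} {A : Matrix β α (RatFunc ℂ)}
    (hE : InRHinf Ebar) (h12 : InRHinf E12) (h21 : InRHinf E21) (h22 : InRHinf E22)
    (hA : InRHinf A) (hF : InRHinf (T' - T))
    (hT : T - T * (Ebar + R) * Sg = Sg) (hT' : T' = Sh + Sh * (Ebar + R) * T')
    (hR : ∀ (x : Matrix y u (RatFunc ℂ)) (q : Matrix β u (RatFunc ℂ)),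
      q = A * (E21 * x + E22 * q) → E12 * q = R * x)
    {M : Matrix y u (RatFunc ℂ)} (hM : M = (1 - Sg * S.toBlocks₂₂)⁻¹ * Sg)
    {V : Matrix (α ⊕ (u ⊕ α)) (α ⊕ (u ⊕ α)) (RatFunc ℂ)} {VC : Matrix z z (RatFunc ℂ)}
    {W : Matrix (β ⊕ (y ⊕ β)) (β ⊕ (y ⊕ β)) (RatFunc ℂ)} {WC : Matrix w w (RatFunc ℂ)}
    (hV : IsBistableBiproper (diag2 V VC)) (hW : IsBistableBiproper (diag2 W WC))
    {D₁ : Matrix (α ⊕ (u ⊕ α)) (α ⊕ (u ⊕ α)) ℂ} {D₂ : Matrix (β ⊕ (y ⊕ β)) (β ⊕ (y ⊕ β)) ℂ}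
    (hD₁ : D₁.PosDef) (hD₂ : D₂.PosSemidef) {η γ : ℝ}
    (hη : 0 ≤ η) (hη' : η ≤ 1) (hηγ : η * γ ^ 2 < 1)
    (hN : ScaledBound (diag2 V VC * fromBlocks (netN M (S.toBlocks₂₂ - Ebar) E12 E21 E22)
        (netIn M (S.toBlocks₂₂ - Ebar) E21 * S.toBlocks₂₁)
        (S.toBlocks₁₂ * netOut M (S.toBlocks₂₂ - Ebar) E12) 0 * diag2 W WC)
      (diag2 D₁ 1, diag2 D₂ 1) η)
    (hΔD : ∀ ω, (((γ ^ 2 : ℝ) : ℂ) • D₂ -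
      freqResp (W⁻¹ * diag2 A (diag2 (T' - T) A) * V⁻¹) ω * D₁ *
        (freqResp (W⁻¹ * diag2 A (diag2 (T' - T) A) * V⁻¹) ω)ᴴ).PosSemidef) :
    WellPosed S Sh ∧ InternallyStable S Sh ∧
      lowerLFT S Sh - lowerLFT S Sg ∈ highSpec VC WC := by
  rw [closedLoop_eq hwp] at hM
  -- $M=\Sigma_B(I-S_{22}\Sigma_B)^{-1}$ is the nominal closed-loop map from $d_1$ to $y$.
  have hMs : InRHinf M := by rw [hM]; exact hst.2.2.2.2.1
  have hMfix : M = Sg * (1 + S.toBlocks₂₂ * M) := by rw [hM]; exact closedLoop_fixed hwp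
  have hS12 : InRHinf S.toBlocks₁₂ := hS.submatrix Sum.inl Sum.inr
  have hS21 : InRHinf S.toBlocks₂₁ := hS.submatrix Sum.inr Sum.inl
  have hY : InRHinf (S.toBlocks₂₂ - Ebar) := InRHinf.sub (hS.submatrix Sum.inr Sum.inr) hE
  have hΔ : InRHinf (diag2 A (diag2 (T' - T) A)) := hA.diag2 (hF.diag2 hA)
  obtain ⟨X, hX, hX1, hX2⟩ := robust_performance_weighted hV hW (hMs.netN hY h12 h21 h22)
    ((hMs.netIn hY h21).mul hS21) (hS12.mul (hMs.netOut hY h12)) hΔ hD₁ hD₂ hη hη' hηγ hN hΔD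
  -- $P$ is the change $M'-M$ of the closed-loop map; $S_{12}$ and $S_{21}$ carry it to the external
  -- channels.
  set P := netOut M (S.toBlocks₂₂ - Ebar) E12 * diag2 A (diag2 (T' - T) A) * X *
    netIn M (S.toBlocks₂₂ - Ebar) E21 with hP
  have hPs : InRHinf P := (((hMs.netOut hY h12).mul hΔ).mul hX).mul (hMs.netIn hY h21)
  obtain ⟨c1, c2, c3⟩ := wellPosed_of_closedLoop hS (hMs.add hPs)
    (perturbed_closedLoop hMfix hT hT' hR hX1 rfl)
  obtain ⟨-, -, c4⟩ := wellPosed_of_closedLoop hS hMs hMfix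
  have hdiff : lowerLFT S Sh - lowerLFT S Sg = S.toBlocks₁₂ * P * S.toBlocks₂₁ := by
    rw [c3, c4, Matrix.mul_add, Matrix.add_mul]
    abel
  refine ⟨c1, c2, ?_, ?_⟩
  · rw [hdiff]
    exact (hS12.mul hPs).mul hS21
  · rw [hdiff, hP]
    simpa only [Matrix.mul_assoc] using hX2

end Stability

/-! ### Inverses and definiteness of block-diagonal matrices -/

section BlockDiagonal

/-- The $i$-th diagonal block of the full inverse is a right inverse of `G i`, because block row $i$
has no other nonzero block. -/
theorem isUnit_det_of_blockDiagonal' {ι R : Type*} [CommRing R] [Fintype ι] [DecidableEq ι]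
    {n : ι → Type*} [∀ i, Fintype (n i)] [∀ i, DecidableEq (n i)] {G : ∀ i, Matrix (n i) (n i) R}
    (h : IsUnit (blockDiagonal' G).det) (i : ι) : IsUnit (G i).det := by
  have h1 := Matrix.mul_nonsing_inv _ h
  refine Matrix.isUnit_det_of_right_inverse (B := blockDiag' (blockDiagonal' G)⁻¹ i) ?_
  ext x x'
  have h2 := congrFun (congrFun h1 ⟨i, x⟩) ⟨i, x'⟩
  rw [Matrix.mul_apply, Fintype.sum_sigma, Finset.sum_eq_single i] at h2
  · simp only [blockDiagonal'_apply_eq] at h2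
    rw [Matrix.mul_apply]
    simp only [blockDiag'_apply]
    rw [h2, Matrix.one_apply, Matrix.one_apply]
    simp
  · intro j _ hj
    exact Finset.sum_eq_zero fun y _ => by rw [blockDiagonal'_apply_ne _ _ _ hj.symm, zero_mul]
  · simp

theorem inv_blockDiagonal' {ι R : Type*} [CommRing R] [Fintype ι] [DecidableEq ι]
    {n : ι → Type*} [∀ i, Fintype (n i)] [∀ i, DecidableEq (n i)] {G : ∀ i, Matrix (n i) (n i) R}
    (h : ∀ i, IsUnit (G i).det) : (blockDiagonal' G)⁻¹ = blockDiagonal' fun i => (G i)⁻¹ := by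
  apply Matrix.inv_eq_right_inv
  rw [← blockDiagonal'_mul]
  simp only [Matrix.mul_nonsing_inv _ (h _)]
  exact blockDiagonal'_one

theorem blockDiagonal'_weighted {ι R : Type*} [CommRing R] [Fintype ι] [DecidableEq ι]
    {m n : ι → Type*} [∀ i, Fintype (n i)] [∀ i, DecidableEq (n i)] [∀ i, Fintype (m i)]
    [∀ i, DecidableEq (m i)] {W : ∀ i, Matrix (m i) (m i) R} {V : ∀ i, Matrix (n i) (n i) R}
    (hW : IsUnit (blockDiagonal' W).det) (hV : IsUnit (blockDiagonal' V).det)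
    (Δ : ∀ i, Matrix (m i) (n i) R) :
    (blockDiagonal' W)⁻¹ * blockDiagonal' Δ * (blockDiagonal' V)⁻¹ =
      blockDiagonal' fun i => (W i)⁻¹ * Δ i * (V i)⁻¹ := by
  rw [inv_blockDiagonal' (isUnit_det_of_blockDiagonal' hW),
    inv_blockDiagonal' (isUnit_det_of_blockDiagonal' hV), ← blockDiagonal'_mul,
    ← blockDiagonal'_mul]

theorem Matrix.PosSemidef.diag2 {a b : Type*} [Fintype a] [Fintype b] {A : Matrix a a ℂ}
    {B : Matrix b b ℂ} (hA : A.PosSemidef) (hB : B.PosSemidef) : (diag2 A B).PosSemidef := by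
  rw [posSemidef_iff_dotProduct_mulVec] at *
  refine ⟨IsHermitian.fromBlocks hA.1 (by simp) hB.1, fun x => ?_⟩
  have h := add_nonneg (hA.2 (x ∘ Sum.inl)) (hB.2 (x ∘ Sum.inr))
  convert h using 1
  simp only [dotProduct, mulVec, _root_.diag2, Fintype.sum_sum_type]
  simp

theorem Matrix.PosSemidef.blockDiagonal' {ι : Type*} [Fintype ι] [DecidableEq ι] {n : ι → Type*}
    [∀ i, Fintype (n i)] {A : ∀ i, Matrix (n i) (n i) ℂ} (hA : ∀ i, (A i).PosSemidef) :
    (Matrix.blockDiagonal' A).PosSemidef := by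
  rw [posSemidef_iff_dotProduct_mulVec]
  constructor
  · rw [Matrix.IsHermitian, blockDiagonal'_conjTranspose]
    congr 1
    exact funext fun i => (hA i).1
  · intro x
    have h : 0 ≤ ∑ i, star (fun y => x ⟨i, y⟩) ⬝ᵥ A i *ᵥ fun y => x ⟨i, y⟩ :=
      Finset.sum_nonneg fun i _ => (posSemidef_iff_dotProduct_mulVec.mp (hA i)).2 _
    convert h using 1
    simp only [dotProduct, mulVec, Fintype.sum_sigma, Pi.star_apply]
    refine Finset.sum_congr rfl fun i _ => Finset.sum_congr rfl fun y _ => ?_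
    congr 1
    rw [Finset.sum_eq_single i]
    · simp only [blockDiagonal'_apply_eq]
    · intro j _ hj
      exact Finset.sum_eq_zero fun y _ => by rw [blockDiagonal'_apply_ne _ _ _ hj.symm, zero_mul]
    · simp

theorem Matrix.PosDef.diag2 {a b : Type*} [Fintype a] [Fintype b] [DecidableEq a] [DecidableEq b]
    {A : Matrix a a ℂ} {B : Matrix b b ℂ} (hA : A.PosDef) (hB : B.PosDef) :
    (diag2 A B).PosDef := by
  rw [(hA.posSemidef.diag2 hB.posSemidef).posDef_iff_det_ne_zero, _root_.diag2,
    det_fromBlocks_zero₂₁]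
  exact mul_ne_zero (hA.posSemidef.posDef_iff_det_ne_zero.mp hA)
    (hB.posSemidef.posDef_iff_det_ne_zero.mp hB)

theorem Matrix.PosDef.blockDiagonal' {ι : Type*} [Fintype ι] [DecidableEq ι] {n : ι → Type*}
    [∀ i, Fintype (n i)] [∀ i, DecidableEq (n i)] {A : ∀ i, Matrix (n i) (n i) ℂ}
    (hA : ∀ i, (A i).PosDef) : (Matrix.blockDiagonal' A).PosDef := by
  rw [(PosSemidef.blockDiagonal' fun i => (hA i).posSemidef).posDef_iff_isUnit,
    isUnit_iff_isUnit_det]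
  refine Matrix.isUnit_det_of_right_inverse (B := Matrix.blockDiagonal' fun i => (A i)⁻¹) ?_
  rw [← blockDiagonal'_mul]
  simp only [Matrix.mul_nonsing_inv _ ((isUnit_iff_isUnit_det _).mp (hA _).isUnit)]
  exact blockDiagonal'_one

end BlockDiagonal

/-! ### Scalings for repeated error blocks -/

section Scaling

variable {k : ℕ}

/-- The part of the sorted scaling that belongs to the low-level errors. -/
def errorScaling {ρ : Fin k → Type} (Sc : ∀ j, Matrix (ρ j) (ρ j) ℂ) (d : Fin k → ℝ)
    (a b : Fin k → ℕ) :
    Matrix ((Σ j, ρ j × Fin (a j)) ⊕ Stack b) ((Σ j, ρ j × Fin (a j)) ⊕ Stack b) ℂ :=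
  diag2 (blockDiagonal' fun j => Sc j ⊗ₖ (1 : Matrix (Fin (a j)) (Fin (a j)) ℂ))
    (blockDiagonal' fun j => (d j : ℂ) • (1 : Matrix (Fin (b j)) (Fin (b j)) ℂ))

/-- The sorted repeated low-level errors. -/
def sortedError (ρ : Fin k → Type) [∀ j, DecidableEq (ρ j)] {a b a' b' : Fin k → ℕ}
    (A : ∀ j, Matrix (Fin (a' j)) (Fin (a j)) ℂ) (F : ∀ j, Matrix (Fin (b' j)) (Fin (b j)) ℂ) :
    Matrix ((Σ j, ρ j × Fin (a' j)) ⊕ Stack b') ((Σ j, ρ j × Fin (a j)) ⊕ Stack b) ℂ :=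
  diag2 (blockDiagonal' fun j => (1 : Matrix (ρ j) (ρ j) ℂ) ⊗ₖ A j) (blockDiagonal' F)

variable {ρ : Fin k → Type} [∀ j, Fintype (ρ j)] [∀ j, DecidableEq (ρ j)]
  {Sc : ∀ j, Matrix (ρ j) (ρ j) ℂ} {d : Fin k → ℝ}

theorem errorScaling_posDef (hSc : ∀ j, (Sc j).PosDef) (hd : ∀ j, 0 < d j) (a b : Fin k → ℕ) :
    (errorScaling Sc d a b).PosDef :=
  (PosDef.blockDiagonal' fun j => (hSc j).kronecker PosDef.one).diag2
    (PosDef.blockDiagonal' fun j => PosDef.one.smul (by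
      have := hd j
      rwa [← Complex.zero_lt_real] at this))

/-- For repeated blocks, $\gamma^2(Q\otimes I)-(I\otimes A)(Q\otimes I)(I\otimes
A)^H=Q\otimes(\gamma^2I-AA^H)$ is a Kronecker product of semidefinite matrices. This is why a full
matrix $Q$ is admissible. The reduction errors occur once and carry only a scalar. -/
theorem errorScaling_sub_posSemidef (hSc : ∀ j, (Sc j).PosDef) (hd : ∀ j, 0 < d j)
    {a b a' b' : Fin k → ℕ} {A : ∀ j, Matrix (Fin (a' j)) (Fin (a j)) ℂ}
    {F : ∀ j, Matrix (Fin (b' j)) (Fin (b j)) ℂ} {γ : ℝ}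
    (hA : ∀ j, matSpectralNorm (A j) ≤ γ) (hF : ∀ j, matSpectralNorm (F j) ≤ γ) :
    (((γ ^ 2 : ℝ) : ℂ) • errorScaling Sc d a' b' -
      sortedError ρ A F * errorScaling Sc d a b * (sortedError ρ A F)ᴴ).PosSemidef := by
  have hA' (j : Fin k) := norm_sq_smul_one_sub_posSemidef (hA j)
  have hF' (j : Fin k) := norm_sq_smul_one_sub_posSemidef (hF j)
  have h1 := PosSemidef.blockDiagonal' fun j => (hSc j).posSemidef.kronecker (hA' j)
  have h2 := PosSemidef.blockDiagonal' fun j => (hF' j).smul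
    (show (0 : ℂ) ≤ (d j : ℂ) by rw [Complex.zero_le_real]; exact (hd j).le)
  convert h1.diag2 h2 using 1
  have e : (sortedError ρ A F)ᴴ = diag2 (blockDiagonal' fun j =>
      (1 : Matrix (ρ j) (ρ j) ℂ) ⊗ₖ (A j)ᴴ) (blockDiagonal' fun j => (F j)ᴴ) := by
    rw [sortedError, diag2, fromBlocks_conjTranspose, blockDiagonal'_conjTranspose,
      blockDiagonal'_conjTranspose]
    simp [diag2, conjTranspose_kronecker]
  rw [e, sortedError, errorScaling, errorScaling, diag2_mul_diag2, diag2_mul_diag2,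
    ← blockDiagonal'_mul, ← blockDiagonal'_mul, ← blockDiagonal'_mul, ← blockDiagonal'_mul]
  simp only [diag2, fromBlocks_smul, smul_zero, ← blockDiagonal'_smul]
  rw [sub_eq_add_neg, fromBlocks_neg, fromBlocks_add]
  simp only [← sub_eq_add_neg, sub_zero, ← blockDiagonal'_sub]
  congr 2
  · funext j
    simp only [Pi.sub_apply, Pi.smul_apply, ← mul_kronecker_mul, Matrix.one_mul, Matrix.mul_one]
    ext ⟨i, x⟩ ⟨i', x'⟩
    simp only [Matrix.sub_apply, Matrix.smul_apply, kroneckerMap_apply, smul_eq_mul]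
    ring
  · funext j
    simp only [Pi.sub_apply, Pi.smul_apply, Matrix.mul_smul, Matrix.mul_one, Matrix.smul_mul,
      smul_sub, smul_smul, mul_comm]

theorem submatrix_scaled_posSemidef {a b c d : Type*} [Fintype a] [Fintype b] [Fintype c]
    [Fintype d] (e' : c ≃ a) (e : d ≃ b) {D₁ : Matrix b b ℂ} {D₂ : Matrix a a ℂ}
    {Δ : Matrix a b ℂ} {r : ℂ} (h : (r • D₂ - Δ * D₁ * Δᴴ).PosSemidef) :
    (r • D₂.submatrix e' e' - Δ.submatrix e' e * D₁.submatrix e e *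
      (Δ.submatrix e' e)ᴴ).PosSemidef := by
  convert h.submatrix e' using 1
  rw [conjTranspose_submatrix, submatrix_mul_equiv, submatrix_mul_equiv]
  rfl

/-- Sorting of the error channels for environment abstraction. -/
def sortErrorE (a b : Fin k → ℕ) :
    Stack a ⊕ (Stack b ⊕ Stack a) ≃ (Σ j : Fin k, Fin 2 × Fin (a j)) ⊕ Stack b where
  toFun
    | Sum.inl ⟨j, x⟩ => Sum.inl ⟨j, (0, x)⟩
    | Sum.inr (Sum.inl x) => Sum.inr x
    | Sum.inr (Sum.inr ⟨j, x⟩) => Sum.inl ⟨j, (1, x)⟩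
  invFun
    | Sum.inl ⟨j, (0, x)⟩ => Sum.inl ⟨j, x⟩
    | Sum.inl ⟨j, (1, x)⟩ => Sum.inr (Sum.inr ⟨j, x⟩)
    | Sum.inr x => Sum.inr (Sum.inl x)
  left_inv := by rintro (⟨j, x⟩ | x | ⟨j, x⟩) <;> rfl
  right_inv := by
    rintro (⟨j, i, x⟩ | x)
    · fin_cases i <;> rfl
    · rfl

/-- Sorting of the error channels for subsystem abstraction. -/
def sortErrorS (a b : Fin k → ℕ) :
    (Σ j, StackBut a j) ⊕ (Stack b ⊕ Σ j, StackBut a j) ≃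
      (Σ l : Fin k, (Fin 2 × {j : Fin k // j ≠ l}) × Fin (a l)) ⊕ Stack b where
  toFun
    | Sum.inl ⟨j, ⟨l, x⟩⟩ => Sum.inl ⟨l, ((0, ⟨j, l.2.symm⟩), x)⟩
    | Sum.inr (Sum.inl x) => Sum.inr x
    | Sum.inr (Sum.inr ⟨j, ⟨l, x⟩⟩) => Sum.inl ⟨l, ((1, ⟨j, l.2.symm⟩), x)⟩
  invFun
    | Sum.inl ⟨l, ((0, j), x)⟩ => Sum.inl ⟨j, ⟨⟨l, j.2.symm⟩, x⟩⟩
    | Sum.inl ⟨l, ((1, j), x)⟩ => Sum.inr (Sum.inr ⟨j, ⟨⟨l, j.2.symm⟩, x⟩⟩)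
    | Sum.inr x => Sum.inr (Sum.inl x)
  left_inv := by rintro (⟨j, l, x⟩ | x | ⟨j, l, x⟩) <;> rfl
  right_inv := by
    rintro (⟨l, ⟨i, j⟩, x⟩ | x)
    · fin_cases i <;> rfl
    · rfl

/-- The external channel is unscaled and splits off as an identity block, so only the error channels
need sorting, and on these the sorting is a bijection. -/
theorem sortedScaling_sortE (Sc : Fin k → Matrix (Fin 2) (Fin 2) ℂ) (d : Fin k → ℝ)
    (a b : Fin k → ℕ) (c : ℕ) :
    (sortedScaling Sc d a b c).submatrix (sortE a b c) (sortE a b c) =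
      diag2 ((errorScaling Sc d a b).submatrix (sortErrorE a b) (sortErrorE a b)) 1 := by
  ext ((⟨j, x⟩ | x | ⟨j, x⟩) | e) ((⟨j', x'⟩ | x' | ⟨j', x'⟩) | e') <;> rfl

theorem sortedScaling_sortS
    (Sc : ∀ l : Fin k, Matrix (Fin 2 × {j : Fin k // j ≠ l}) (Fin 2 × {j : Fin k // j ≠ l}) ℂ)
    (d : Fin k → ℝ) (a b : Fin k → ℕ) (c : ℕ) :
    (sortedScaling Sc d a b c).submatrix (sortS a b c) (sortS a b c) =
      diag2 ((errorScaling Sc d a b).submatrix (sortErrorS a b) (sortErrorS a b)) 1 := by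
  ext ((⟨j, l, x⟩ | x | ⟨j, l, x⟩) | e) ((⟨j', l', x'⟩ | x' | ⟨j', l', x'⟩) | e') <;> rfl

theorem diag2_eq_sortedError_E {a b a' b' : Fin k → ℕ}
    (A : ∀ j, Matrix (Fin (a' j)) (Fin (a j)) ℂ) (F : ∀ j, Matrix (Fin (b' j)) (Fin (b j)) ℂ) :
    diag2 (blockDiagonal' A) (diag2 (blockDiagonal' F) (blockDiagonal' A)) =
      (sortedError (fun _ => Fin 2) A F).submatrix (sortErrorE a' b') (sortErrorE a b) := by
  have key (i i' : Fin 2) (j j' : Fin k) (x : Fin (a' j)) (x' : Fin (a j')) :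
      (if i = i' then blockDiagonal' A ⟨j, x⟩ ⟨j', x'⟩ else 0) =
      (blockDiagonal' fun j : Fin k => (1 : Matrix (Fin 2) (Fin 2) ℂ) ⊗ₖ A j)
        ⟨j, (i, x)⟩ ⟨j', (i', x')⟩ := by
    by_cases hj : j = j'
    · subst hj
      simp [blockDiagonal'_apply, Matrix.one_apply]
    · rw [blockDiagonal'_apply_ne _ _ _ hj, blockDiagonal'_apply_ne _ _ _ hj, ite_self]
  ext (⟨j, x⟩ | x | ⟨j, x⟩) (⟨j', x'⟩ | x' | ⟨j', x'⟩)
  · exact (if_pos rfl).symm.trans (key 0 0 j j' x x')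
  · rfl
  · exact (if_neg (by decide)).symm.trans (key 0 1 j j' x x')
  · rfl
  · rfl
  · rfl
  · exact (if_neg (by decide)).symm.trans (key 1 0 j j' x x')
  · rfl
  · exact (if_pos rfl).symm.trans (key 1 1 j j' x x')

/-- The errors are listed by environment $j$ and then by subsystem $l\ne j$. Exchanging the two
indices collects the $2(k-1)$ copies of the error of $l$ into $I\otimes\Delta_A^l$. -/
theorem diag2_eq_sortedError_S {a b a' b' : Fin k → ℕ}
    (A : ∀ j, Matrix (Fin (a' j)) (Fin (a j)) ℂ) (F : ∀ j, Matrix (Fin (b' j)) (Fin (b j)) ℂ) :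
    diag2 (blockDiagonal' fun j => blockDiagonal' fun l : {l : Fin k // l ≠ j} => A l)
      (diag2 (blockDiagonal' F)
        (blockDiagonal' fun j => blockDiagonal' fun l : {l : Fin k // l ≠ j} => A l)) =
      (sortedError (fun l => Fin 2 × {j : Fin k // j ≠ l}) A F).submatrix
        (sortErrorS a' b') (sortErrorS a b) := by
  have key (i i' : Fin 2) (j j' : Fin k) (l : {l : Fin k // l ≠ j}) (l' : {l : Fin k // l ≠ j'})
      (x : Fin (a' l)) (x' : Fin (a l')) :
      (if i = i' then (blockDiagonal' fun j => blockDiagonal' fun l : {l : Fin k // l ≠ j} => A l)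
        ⟨j, l, x⟩ ⟨j', l', x'⟩ else 0) =
      (blockDiagonal' fun l : Fin k => (1 : Matrix (Fin 2 × {j : Fin k // j ≠ l})
        (Fin 2 × {j : Fin k // j ≠ l}) ℂ) ⊗ₖ A l)
        ⟨l, ((i, ⟨j, l.2.symm⟩), x)⟩ ⟨l', ((i', ⟨j', l'.2.symm⟩), x')⟩ := by
    obtain ⟨l, hl⟩ := l
    obtain ⟨l', hl'⟩ := l'
    by_cases hll : l = l'
    · subst hll
      by_cases hj : j = j'
      · subst hj
        simp [blockDiagonal'_apply, Matrix.one_apply]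
      · simp [blockDiagonal'_apply, hj]
    · rw [blockDiagonal'_apply_ne _ _ _ hll]
      by_cases hj : j = j'
      · subst hj
        rw [blockDiagonal'_apply_eq, blockDiagonal'_apply_ne]
        · simp
        · simpa using hll
      · rw [blockDiagonal'_apply_ne _ _ _ hj, ite_self]
  ext (⟨j, l, x⟩ | x | ⟨j, l, x⟩) (⟨j', l', x'⟩ | x' | ⟨j', l', x'⟩)
  · exact (if_pos rfl).symm.trans (key 0 0 j j' l l' x x')
  · rfl
  · exact (if_neg (by decide)).symm.trans (key 0 1 j j' l l' x x')
  · rfl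
  · rfl
  · rfl
  · exact (if_neg (by decide)).symm.trans (key 1 0 j j' l l' x x')
  · rfl
  · exact (if_pos rfl).symm.trans (key 1 1 j j' l l' x x')

end Scaling

/-! ### Low-level error bounds and normalized reduction errors -/

section LowLevel

/-- Unifies the two strictness alternatives into $\eta\gamma^2<1$: the slack sits either in $\eta$
(with $\gamma=1$) or in $\gamma$ (with $\eta=1$). -/
theorem exists_rates {a b : Type*} [Fintype a] [Fintype b] [DecidableEq a]
    [DecidableEq b] {N : Matrix a b (RatFunc ℂ)}
    {D : Matrix a a ℂ × Matrix b b ℂ} (hD : D.1.PosSemidef) (h : ScaledBound N D 1)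
    {k : ℕ} {x y : Fin k → ENNReal} (hx : ∀ i, x i ≤ 1) (hy : ∀ i, y i ≤ 1)
    (hstrict : (∃ η : ℝ, η < 1 ∧ ScaledBound N D η) ∨ ((∀ i, x i < 1) ∧ ∀ i, y i < 1)) :
    ∃ η γ : ℝ, 0 ≤ η ∧ η ≤ 1 ∧ 0 ≤ γ ∧ η * γ ^ 2 < 1 ∧ ScaledBound N D η ∧
      (∀ i, x i ≤ ENNReal.ofReal γ) ∧ ∀ i, y i ≤ ENNReal.ofReal γ := by
  rcases hstrict with ⟨η, hη, hb⟩ | ⟨hx', hy'⟩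
  -- The given rate may be negative; raising it to 0 keeps the inequality valid.
  · refine ⟨max η 0, 1, le_max_right _ _, max_le hη.le zero_le_one, zero_le_one, ?_,
      hb.mono hD (le_max_left _ _), by simpa using hx, by simpa using hy⟩
    simpa using hη
  -- Finitely many norms below 1 have maximum below 1; without subsystems the supremum is 0.
  · set c : ENNReal := max (Finset.univ.sup x) (Finset.univ.sup y) with hc
    have hc1 : c < 1 := by
      refine max_lt ?_ ?_
      · rw [Finset.sup_lt_iff (by simp)]
        exact fun i _ => hx' i
      · rw [Finset.sup_lt_iff (by simp)]
        exact fun i _ => hy' i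
    have hc2 : ENNReal.ofReal c.toReal = c := ENNReal.ofReal_toReal (hc1.trans_le le_top).ne
    have hc3 : c.toReal < 1 := by
      rw [← ENNReal.toReal_one]
      exact (ENNReal.toReal_lt_toReal (hc1.trans_le le_top).ne ENNReal.one_ne_top).mpr hc1
    refine ⟨1, c.toReal, zero_le_one, le_rfl, ENNReal.toReal_nonneg, ?_, h, fun i => ?_,
      fun i => ?_⟩
    · rw [one_mul]
      exact pow_lt_one₀ ENNReal.toReal_nonneg hc3 two_ne_zero
    · rw [hc2]
      exact (Finset.le_sup (Finset.mem_univ i)).trans (le_max_left _ _)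
    · rw [hc2]
      exact (Finset.le_sup (Finset.mem_univ i)).trans (le_max_right _ _)

theorem matSpectralNorm_le_of_hinfNorm_le {a b : Type*} [Fintype a] [Fintype b] [DecidableEq b]
    {G : Matrix a b (RatFunc ℂ)} {γ : ℝ} (hγ : 0 ≤ γ) (h : hinfNorm G ≤ ENNReal.ofReal γ)
    (ω : ℝ) : matSpectralNorm (freqResp G ω) ≤ γ :=
  (ENNReal.ofReal_le_ofReal_iff hγ).mp ((le_iSup _ ω).trans h)

theorem freqResp_diag2 {a b c d : Type*} (A : Matrix a b (RatFunc ℂ)) (B : Matrix c d (RatFunc ℂ))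
    (ω : ℝ) : freqResp (diag2 A B) ω = diag2 (freqResp A ω) (freqResp B ω) := by
  ext (i | i) (j | j)
  · rfl
  · exact RatFunc.eval_zero _ _
  · exact RatFunc.eval_zero _ _
  · rfl

theorem freqResp_blockDiagonal' {ι : Type*} [DecidableEq ι] {m n : ι → Type*}
    (G : ∀ i, Matrix (m i) (n i) (RatFunc ℂ)) (ω : ℝ) :
    freqResp (blockDiagonal' G) ω = blockDiagonal' fun i => freqResp (G i) ω :=
  blockDiagonal'_map _ _ (RatFunc.eval_zero _ _)

variable {pC mC a b : ℕ}

theorem map_C_isUnit_det {G : Matrix (Fin a) (Fin a) ℂ} (h : IsUnit G.det) :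
    IsUnit (G.map RatFunc.C).det := by
  rw [← RingHom.mapMatrix_apply, ← RingHom.map_det]
  exact h.map _

/-- In the (2,2) block the augmentation contributes only outer factors $G_y$, $G_u$ and no
feedthrough, so normalization removes them and leaves a difference of closed loops. -/
theorem redErrorNorm_eq (E : Matrix (Fin pC ⊕ Fin a) (Fin mC ⊕ Fin b) (RatFunc ℂ))
    {Gu : Matrix (Fin a) (Fin a) ℂ} {Gy : Matrix (Fin b) (Fin b) ℂ}
    (hu : IsUnit Gu.det) (hy : IsUnit Gy.det) (G Gh : Matrix (Fin b) (Fin a) (RatFunc ℂ)) :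
    redErrorNorm E Gu Gy G Gh =
      Gh * (1 - E.toBlocks₂₂ * Gh)⁻¹ - G * (1 - E.toBlocks₂₂ * G)⁻¹ := by
  have h (K : Matrix (Fin b) (Fin a) (RatFunc ℂ)) :
      (lowerLFT (augEnv E Gu Gy) K).toBlocks₂₂ =
        Gy.map RatFunc.C * (K * (1 - E.toBlocks₂₂ * K)⁻¹) * Gu.map RatFunc.C := by
    have : (lowerLFT (augEnv E Gu Gy) K).toBlocks₂₂ =
        Gy.map RatFunc.C * K * (1 - E.toBlocks₂₂ * K)⁻¹ * Gu.map RatFunc.C + 0 := rfl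
    rw [this, add_zero, Matrix.mul_assoc (Gy.map RatFunc.C) K]
  have h2 : (redError E Gu Gy G Gh).toBlocks₂₂ = (lowerLFT (augEnv E Gu Gy) Gh).toBlocks₂₂ -
      (lowerLFT (augEnv E Gu Gy) G).toBlocks₂₂ := rfl
  rw [redErrorNorm, h2, h, h, ← Matrix.sub_mul, ← Matrix.mul_sub]
  rw [Matrix.mul_assoc, Matrix.mul_assoc _ (Gu.map RatFunc.C),
    Matrix.mul_nonsing_inv _ (map_C_isUnit_det hu), Matrix.mul_one, ← Matrix.mul_assoc,
    Matrix.nonsing_inv_mul _ (map_C_isUnit_det hy), Matrix.one_mul]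

theorem WellPosed.isUnit_augEnv {E : Matrix (Fin pC ⊕ Fin a) (Fin mC ⊕ Fin b) (RatFunc ℂ)}
    {Gu : Matrix (Fin a) (Fin a) ℂ} {Gy : Matrix (Fin b) (Fin b) ℂ}
    {K : Matrix (Fin b) (Fin a) (RatFunc ℂ)} (h : WellPosed (augEnv E Gu Gy) K) :
    IsUnit (1 - E.toBlocks₂₂ * K).det := h.1

end LowLevel

/-! ### The two kinds of abstraction -/

section Subsystems

variable {k : ℕ} {m p : Fin k → ℕ}

/-- The parallel connection of the loops of all subsystems with their environments. -/
def parLoop (E : ∀ j, Matrix (Fin (m j)) (Fin (p j)) (RatFunc ℂ))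
    (G : ∀ j, Matrix (Fin (p j)) (Fin (m j)) (RatFunc ℂ)) :
    Matrix (Stack p) (Stack m) (RatFunc ℂ) :=
  par fun j => G j * (1 - E j * G j)⁻¹

variable {E : ∀ j, Matrix (Fin (m j)) (Fin (p j)) (RatFunc ℂ)}
  {G : ∀ j, Matrix (Fin (p j)) (Fin (m j)) (RatFunc ℂ)}

/-- The loop $T=G(I-EG)^{-1}$ satisfies $T=G+TEG$ as well as $T=G+GET$. The first form serves to
open up the nominal loop, the second, in `parLoop_eq`, to reassemble the reduced one. -/
theorem parLoop_sub (h : ∀ j, IsUnit (1 - E j * G j).det) :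
    parLoop E G - parLoop E G * par E * par G = par G := by
  rw [parLoop, par, par, par, ← blockDiagonal'_mul, ← blockDiagonal'_mul, ← blockDiagonal'_sub]
  congr 1
  funext j
  have h1 := Matrix.nonsing_inv_mul _ (h j)
  calc G j * (1 - E j * G j)⁻¹ - G j * (1 - E j * G j)⁻¹ * E j * G j
      = G j * ((1 - E j * G j)⁻¹ * (1 - E j * G j)) := by
        simp only [Matrix.mul_sub, Matrix.mul_one, Matrix.mul_assoc]
    _ = G j := by rw [h1, Matrix.mul_one]

theorem parLoop_eq (h : ∀ j, IsUnit (1 - E j * G j).det) :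
    parLoop E G = par G + par G * par E * parLoop E G := by
  rw [parLoop, par, par, par, ← blockDiagonal'_mul, ← blockDiagonal'_mul, ← blockDiagonal'_add]
  congr 1
  funext j
  have h1 := Matrix.mul_nonsing_inv _ (h j)
  rw [Matrix.sub_mul, Matrix.one_mul, sub_eq_iff_eq_add] at h1
  calc G j * (1 - E j * G j)⁻¹ = G j * (1 + E j * G j * (1 - E j * G j)⁻¹) := by rw [← h1]
    _ = G j + G j * E j * (G j * (1 - E j * G j)⁻¹) := by
      simp only [Matrix.mul_add, Matrix.mul_one, Matrix.mul_assoc]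

theorem par_redErrorNorm {pC mC : ℕ}
    (Eh : ∀ j, Matrix (Fin pC ⊕ Fin (m j)) (Fin mC ⊕ Fin (p j)) (RatFunc ℂ))
    {Gu : ∀ j, Matrix (Fin (m j)) (Fin (m j)) ℂ} {Gy : ∀ j, Matrix (Fin (p j)) (Fin (p j)) ℂ}
    (hu : ∀ j, IsUnit (Gu j).det) (hy : ∀ j, IsUnit (Gy j).det)
    (G Gh : ∀ j, Matrix (Fin (p j)) (Fin (m j)) (RatFunc ℂ)) :
    (par fun j => redErrorNorm (Eh j) (Gu j) (Gy j) (G j) (Gh j)) =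
      parLoop (fun j => (Eh j).toBlocks₂₂) Gh - parLoop (fun j => (Eh j).toBlocks₂₂) G := by
  rw [parLoop, parLoop, par, par, par, ← blockDiagonal'_sub]
  congr 1
  funext j
  exact redErrorNorm_eq _ (hu j) (hy j) _ _

theorem InRHinf.par {r c : Fin k → ℕ} {G : ∀ j, Matrix (Fin (r j)) (Fin (c j)) (RatFunc ℂ)}
    (h : ∀ j, InRHinf (G j)) : InRHinf (par G) := InRHinf.blockDiagonal' h

variable {mC pC : ℕ} {S : Matrix (Fin pC ⊕ Stack m) (Fin mC ⊕ Stack p) (RatFunc ℂ)}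
  {Sig : ∀ j, Matrix (Fin (p j)) (Fin (m j)) (RatFunc ℂ)}

/-- With environment abstraction the error adds directly to $E_{22}$: the channels are identities
without inner feedback. -/
theorem sysNE_eq : sysNE S Sig = fromBlocks
    (netN (sysM S Sig) (sysZ S Sig) 1 1 0)
    (netIn (sysM S Sig) (sysZ S Sig) 1 * S.toBlocks₂₁)
    (S.toBlocks₁₂ * netOut (sysM S Sig) (sysZ S Sig) 1) 0 := by
  simp [sysNE, netN, netIn, netOut, fromRows_mul, mul_fromCols]

/-- Top-down performance with environment abstraction. -/
theorem environment_abstraction_performance (hA : StandingAssumption S Sig)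
    {VC : Matrix (Fin pC) (Fin pC) (RatFunc ℂ)} {WC : Matrix (Fin mC) (Fin mC) (RatFunc ℂ)}
    {VE : ∀ j, Matrix (Fin (p j)) (Fin (p j)) (RatFunc ℂ)}
    {WE : ∀ j, Matrix (Fin (m j)) (Fin (m j)) (RatFunc ℂ)}
    {VF : ∀ j, Matrix (Fin (m j)) (Fin (m j)) (RatFunc ℂ)}
    {WF : ∀ j, Matrix (Fin (p j)) (Fin (p j)) (RatFunc ℂ)}
    (hV : IsBistableBiproper (weightE VE VF VC)) (hW : IsBistableBiproper (weightE WE WF WC))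
    {D} (hD : D ∈ scalingsE m p mC pC)
    (hN : ScaledBound (weightE VE VF VC * sysNE S Sig * weightE WE WF WC) D 1)
    {Ehat : ∀ j, Matrix (Fin pC ⊕ Fin (m j)) (Fin mC ⊕ Fin (p j)) (RatFunc ℂ)}
    {Sighat : ∀ j, Matrix (Fin (p j)) (Fin (m j)) (RatFunc ℂ)}
    {F : ∀ j, Matrix (Fin (p j)) (Fin (m j)) (RatFunc ℂ)}
    (hF : par F = parLoop (fun j => (Ehat j).toBlocks₂₂) Sighat -
      parLoop (fun j => (Ehat j).toBlocks₂₂) Sig)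
    (hwp : ∀ j, IsUnit (1 - (Ehat j).toBlocks₂₂ * Sig j).det)
    (hwp' : ∀ j, IsUnit (1 - (Ehat j).toBlocks₂₂ * Sighat j).det)
    (hAs : ∀ j, InRHinf (Ehat j - env S Sig j).toBlocks₂₂) (hFs : ∀ j, InRHinf (F j))
    (hAn : ∀ j, (Ehat j - env S Sig j).toBlocks₂₂ ∈ lowSpec (WE j) (VE j))
    (hFn : ∀ j, F j ∈ lowSpec (WF j) (VF j))
    (hstrict : (∃ η : ℝ, η < 1 ∧
        ScaledBound (weightE VE VF VC * sysNE S Sig * weightE WE WF WC) D η) ∨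
      ((∀ j, hinfNorm (weightedError (WE j) (VE j) (Ehat j - env S Sig j).toBlocks₂₂) < 1) ∧
        ∀ j, hinfNorm (weightedError (WF j) (VF j) (F j)) < 1)) :
    WellPosed S (par Sighat) ∧ InternallyStable S (par Sighat) ∧
      intError S Sig Sighat ∈ highSpec VC WC := by
  obtain ⟨D1, D2⟩ := D
  obtain ⟨Sc, d, hSc, hd, rfl, rfl⟩ := hD
  simp only [sortedScaling_sortE] at hN hstrict
  have hpd (a b : Fin k → ℕ) := errorScaling_posDef hSc hd a b
  have hpd' (a b : Fin k → ℕ) : ((errorScaling Sc d a b).submatrix (sortErrorE a b)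
      (sortErrorE a b)).PosDef := (hpd a b).submatrix (sortErrorE a b).injective
  obtain ⟨η, γ, hη, hη', hγ, hηγ, hb, hAγ, hFγ⟩ :=
    exists_rates ((hpd' p m).posSemidef.diag2 PosSemidef.one) hN hAn hFn hstrict
  rw [sysNE_eq] at hb
  have hVu := isUnit_det_diag2 (hV.of_diag2.1).2.1
  have hWu := isUnit_det_diag2 (hW.of_diag2.1).2.1
  have hVu' := isUnit_det_diag2 hVu.2
  have hWu' := isUnit_det_diag2 hWu.2
  set EB : Matrix (Stack m) (Stack p) (RatFunc ℂ) :=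
    par fun j => (env S Sig j).toBlocks₂₂ with hEB
  set A : Matrix (Stack m) (Stack p) (RatFunc ℂ) :=
    par fun j => (Ehat j - env S Sig j).toBlocks₂₂ with hAdef
  have hE : EB + A = par fun j => (Ehat j).toBlocks₂₂ := by
    rw [hAdef, hEB, par, par, ← blockDiagonal'_add, par]
    congr 1
    funext j
    ext x y
    exact add_sub_cancel _ _
  refine interconnection_performance (Ebar := EB) (R := A) (A := A) (E12 := 1) (E21 := 1)
    (E22 := 0) (Sg := par Sig) (T := parLoop (fun j => (Ehat j).toBlocks₂₂) Sig)
    (T' := parLoop (fun j => (Ehat j).toBlocks₂₂) Sighat) hA.inter_stable hA.wellPosed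
    hA.internallyStable ?_ InRHinf.one InRHinf.one InRHinf.zero (InRHinf.par hAs) ?_ ?_ ?_ ?_ rfl
    hV hW (hpd' p m) (hpd' m p).posSemidef hη hη' hηγ hb ?_
  · exact InRHinf.par fun j =>
      (hA.env_internallyStable j).2.2.2.2.2.2.1.submatrix Sum.inr Sum.inr
  · rw [← hF]
    exact InRHinf.par hFs
  · rw [hE, parLoop_sub hwp]
  · rw [hE, ← parLoop_eq hwp']
  · intro x q hq
    rw [Matrix.one_mul, Matrix.zero_mul, add_zero] at hq
    rw [Matrix.one_mul, hq]
  · intro ω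
    rw [← hF, inv_diag2 hWu.1 hWu.2, inv_diag2 hVu.1 hVu.2, inv_diag2 hWu'.1 hWu'.2,
      inv_diag2 hVu'.1 hVu'.2]
    simp only [diag2_mul_diag2]
    rw [hAdef, par, par, par, par, par, par, blockDiagonal'_weighted hWu.1 hVu.1,
      blockDiagonal'_weighted hWu'.1 hVu'.1]
    simp only [freqResp_diag2, freqResp_blockDiagonal']
    rw [diag2_eq_sortedError_E]
    exact submatrix_scaled_posSemidef _ _ (errorScaling_sub_posSemidef hSc hd
      (fun j => matSpectralNorm_le_of_hinfNorm_le hγ (hAγ j) ω)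
      (fun j => matSpectralNorm_le_of_hinfNorm_le hγ (hFγ j) ω))

theorem sysNS_eq : sysNS S Sig = fromBlocks
    (netN (sysM S Sig) (S.toBlocks₂₂ - blockDiagonal' (extEnv11 S Sig))
      (blockDiagonal' (extEnv12 S Sig)) (blockDiagonal' (extEnv21 S Sig))
      (blockDiagonal' (extEnv22 S Sig)))
    (netIn (sysM S Sig) (S.toBlocks₂₂ - blockDiagonal' (extEnv11 S Sig))
      (blockDiagonal' (extEnv21 S Sig)) * S.toBlocks₂₁)
    (S.toBlocks₁₂ * netOut (sysM S Sig) (S.toBlocks₂₂ - blockDiagonal' (extEnv11 S Sig))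
      (blockDiagonal' (extEnv12 S Sig))) 0 := by
  simp [sysNS, netN, netIn, netOut, fromRows_mul, mul_fromCols, Matrix.mul_assoc]

theorem env_toBlocks₂₂ (j : Fin k) : (env S Sig j).toBlocks₂₂ =
    (permS S j).toBlocks₁₂.toRows₂ * parBut Sig j *
      (1 - (permS S j).toBlocks₂₂ * parBut Sig j)⁻¹ * (permS S j).toBlocks₂₁.toCols₂ +
      (permS S j).toBlocks₁₁.toBlocks₂₂ := rfl

/-- The shift of a linear fractional transformation from one stable inner loop to another, in
terms of the difference of the inner systems. -/
theorem lft_shift {R a b c e : Type*} [CommRing R] [Fintype a] [DecidableEq a] [Fintype b]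
    [DecidableEq b] {P : Matrix a b R} {G G' : Matrix b a R} {L L' : Matrix a a R}
    (hL : (1 - P * G) * L = 1) (hL' : L' * (1 - P * G') = 1) (hL'' : (1 - P * G') * L' = 1)
    (U : Matrix c b R) (W : Matrix a e R) :
    (1 + (G' - G) * L' * P) * (1 - (G' - G) * (L * P)) = 1 ∧
      U * (1 + G * L * P) * ((1 + (G' - G) * L' * P) * ((G' - G) * (L * W))) =
        U * G' * L' * W - U * G * L * W := by
  -- This is the resolvent identity $L'-L=L'P(G'-G)L$ multiplied by $G'-G$ on the left.
  have h1 : (1 + (G' - G) * L' * P) * (G' - G) * L = (G' - G) * L' := by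
    have e1 : (1 + (G' - G) * L' * P) * (G' - G) = (G' - G) * L' * (1 - P * G) := by
      have h0 : 1 + L' * (P * G') = L' := by rw [← hL', Matrix.mul_sub, Matrix.mul_one]; abel
      calc (1 + (G' - G) * L' * P) * (G' - G)
          = (G' - G) * (1 + L' * (P * G') - L' * (P * G)) := by
            simp only [Matrix.add_mul, Matrix.one_mul, Matrix.mul_one, Matrix.mul_add,
              Matrix.mul_sub, Matrix.mul_assoc]
            abel
        _ = (G' - G) * L' * (1 - P * G) := by
            rw [h0, Matrix.mul_assoc, Matrix.mul_sub L', Matrix.mul_one]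
    rw [e1, Matrix.mul_assoc, hL, Matrix.mul_one]
  refine ⟨?_, ?_⟩
  · rw [Matrix.mul_sub, Matrix.mul_one, ← Matrix.mul_assoc, ← Matrix.mul_assoc, h1,
      add_sub_cancel_right]
  · have hL2 : L * (1 - P * G) = 1 := mul_eq_one_comm.mp hL
    have h2 : (1 + G * L * P) * ((G' - G) * L') = G' * L' - G * L := by
      have e1 : (1 + G * L * P) * (G' - G) = G' - G * L * (1 - P * G') := by
        have h0 : L * (P * G) = L - 1 := by rw [← hL2, Matrix.mul_sub, Matrix.mul_one]; abel
        calc (1 + G * L * P) * (G' - G)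
            = G' - G + G * (L * (P * G') - L * (P * G)) := by
              simp only [Matrix.add_mul, Matrix.one_mul, Matrix.mul_sub, Matrix.mul_assoc]
              abel
          _ = G' - G * L * (1 - P * G') := by
              rw [h0]
              simp only [Matrix.mul_one, Matrix.mul_sub, Matrix.mul_assoc]
              abel
      rw [← Matrix.mul_assoc, e1, Matrix.sub_mul, Matrix.mul_assoc _ _ L', hL'', Matrix.mul_one]
    calc U * (1 + G * L * P) * ((1 + (G' - G) * L' * P) * ((G' - G) * (L * W)))
        = U * ((1 + G * L * P) * ((1 + (G' - G) * L' * P) * (G' - G) * L)) * W := by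
          simp only [Matrix.mul_assoc]
      _ = _ := by
          rw [h1, h2]
          simp only [Matrix.mul_sub, Matrix.sub_mul, Matrix.mul_assoc]

variable {Sigtil : ∀ j, Matrix (Fin (p j)) (Fin (m j)) (RatFunc ℂ)}

theorem parBut_sub (j : Fin k) :
    parBut (fun l => Sigtil l - Sig l) j = parBut Sigtil j - parBut Sig j :=
  blockDiagonal'_sub (fun l : {l : Fin k // l ≠ j} => Sigtil l)
    (fun l : {l : Fin k // l ≠ j} => Sig l)

/-- Replacing the other subsystems by their abstractions changes the environment by a linear
fractional map of the errors. The implicit equation for `q` is solved with the explicit left inverse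
from `lft_shift`, block by block. -/
theorem extEnv_shift (h : ∀ j, WellPosed (permS S j) (parBut Sig j))
    (h' : ∀ j, WellPosed (permS S j) (parBut Sigtil j))
    {c : Type*} (x : Matrix (Stack p) c (RatFunc ℂ))
    (q : Matrix (Σ j, StackBut p j) c (RatFunc ℂ))
    (hq : q = blockDiagonal' (parBut fun l => Sigtil l - Sig l) *
      (blockDiagonal' (extEnv21 S Sig) * x + blockDiagonal' (extEnv22 S Sig) * q)) :
    blockDiagonal' (extEnv12 S Sig) * q =
      ((par fun j => (env S Sigtil j).toBlocks₂₂) - blockDiagonal' (extEnv11 S Sig)) * x := by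
  set A := parBut fun l => Sigtil l - Sig l with hA
  have key (j : Fin k) := lft_shift (P := (permS S j).toBlocks₂₂)
    (Matrix.mul_nonsing_inv _ (h j).1) (Matrix.nonsing_inv_mul _ (h' j).1)
    (Matrix.mul_nonsing_inv _ (h' j).1) (permS S j).toBlocks₁₂.toRows₂
    (permS S j).toBlocks₂₁.toCols₂
  set K : ∀ j, Matrix (StackBut p j) (StackBut p j) (RatFunc ℂ) := fun j =>
    1 + (parBut Sigtil j - parBut Sig j) * (1 - (permS S j).toBlocks₂₂ * parBut Sigtil j)⁻¹ *
      (permS S j).toBlocks₂₂ with hK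
  have hK1 : blockDiagonal' K * (1 - blockDiagonal' A * blockDiagonal' (extEnv22 S Sig)) = 1 := by
    have e : (1 : Matrix (Σ j, StackBut p j) (Σ j, StackBut p j) (RatFunc ℂ)) =
      blockDiagonal' fun _ => 1 := blockDiagonal'_one.symm
    rw [← blockDiagonal'_mul, e, ← blockDiagonal'_sub, ← blockDiagonal'_mul]
    congr 1
    funext j
    rw [hA, Pi.sub_apply, parBut_sub]
    exact (key j).1
  have hK2 : blockDiagonal' (extEnv12 S Sig) *
      (blockDiagonal' K * (blockDiagonal' A * blockDiagonal' (extEnv21 S Sig))) =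
      (par fun j => (env S Sigtil j).toBlocks₂₂) - blockDiagonal' (extEnv11 S Sig) := by
    rw [← blockDiagonal'_mul, ← blockDiagonal'_mul, ← blockDiagonal'_mul, par,
      ← blockDiagonal'_sub]
    congr 1
    funext j
    rw [hA, Pi.sub_apply, parBut_sub]
    refine (key j).2.trans ?_
    rw [env_toBlocks₂₂, extEnv11, extL]
    abel
  have hq1 : (1 - blockDiagonal' A * blockDiagonal' (extEnv22 S Sig)) * q =
      blockDiagonal' A * (blockDiagonal' (extEnv21 S Sig) * x) := by
    rw [Matrix.sub_mul, Matrix.one_mul, sub_eq_iff_eq_add, Matrix.mul_assoc, ← Matrix.mul_add]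
    exact hq
  have hq2 : q = blockDiagonal' K *
      (blockDiagonal' A * (blockDiagonal' (extEnv21 S Sig) * x)) := by
    rw [← hq1, ← Matrix.mul_assoc, hK1, Matrix.one_mul]
  rw [hq2, ← hK2]
  simp only [Matrix.mul_assoc]

theorem InRHinf.parBut {r c : Fin k → ℕ} {G : ∀ j, Matrix (Fin (r j)) (Fin (c j)) (RatFunc ℂ)}
    (h : ∀ j, InRHinf (G j)) (j : Fin k) : InRHinf (parBut G j) :=
  InRHinf.blockDiagonal' fun l => h l

/-- Top-down performance with subsystem abstraction. -/
theorem subsystem_abstraction_performance (hA : StandingAssumption S Sig)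
    {VC : Matrix (Fin pC) (Fin pC) (RatFunc ℂ)} {WC : Matrix (Fin mC) (Fin mC) (RatFunc ℂ)}
    {VA : ∀ j, Matrix (Fin (m j)) (Fin (m j)) (RatFunc ℂ)}
    {WA : ∀ j, Matrix (Fin (p j)) (Fin (p j)) (RatFunc ℂ)}
    {VF : ∀ j, Matrix (Fin (m j)) (Fin (m j)) (RatFunc ℂ)}
    {WF : ∀ j, Matrix (Fin (p j)) (Fin (p j)) (RatFunc ℂ)}
    (hV : IsBistableBiproper (weightS VA VF VC)) (hW : IsBistableBiproper (weightS WA WF WC))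
    {D} (hD : D ∈ scalingsS m p mC pC)
    (hN : ScaledBound (weightS VA VF VC * sysNS S Sig * weightS WA WF WC) D 1)
    {Sighat : ∀ j, Matrix (Fin (p j)) (Fin (m j)) (RatFunc ℂ)}
    {F : ∀ j, Matrix (Fin (p j)) (Fin (m j)) (RatFunc ℂ)}
    (hF : par F = parLoop (fun j => (env S Sigtil j).toBlocks₂₂) Sighat -
      parLoop (fun j => (env S Sigtil j).toBlocks₂₂) Sig)
    (hwpt : ∀ j, WellPosed (permS S j) (parBut Sigtil j))
    (hwp : ∀ j, IsUnit (1 - (env S Sigtil j).toBlocks₂₂ * Sig j).det)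
    (hwp' : ∀ j, IsUnit (1 - (env S Sigtil j).toBlocks₂₂ * Sighat j).det)
    (hAs : ∀ j, InRHinf (Sigtil j - Sig j)) (hFs : ∀ j, InRHinf (F j))
    (hAn : ∀ j, Sigtil j - Sig j ∈ lowSpec (WA j) (VA j))
    (hFn : ∀ j, F j ∈ lowSpec (WF j) (VF j))
    (hstrict : (∃ η : ℝ, η < 1 ∧
        ScaledBound (weightS VA VF VC * sysNS S Sig * weightS WA WF WC) D η) ∨
      ((∀ j, hinfNorm (weightedError (WA j) (VA j) (Sigtil j - Sig j)) < 1) ∧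
        ∀ j, hinfNorm (weightedError (WF j) (VF j) (F j)) < 1)) :
    WellPosed S (par Sighat) ∧ InternallyStable S (par Sighat) ∧
      intError S Sig Sighat ∈ highSpec VC WC := by
  obtain ⟨D1, D2⟩ := D
  obtain ⟨Sc, d, hSc, hd, rfl, rfl⟩ := hD
  simp only [sortedScaling_sortS] at hN hstrict
  have hpd (a b : Fin k → ℕ) := errorScaling_posDef hSc hd a b
  have hpd' (a b : Fin k → ℕ) : ((errorScaling Sc d a b).submatrix (sortErrorS a b)
      (sortErrorS a b)).PosDef := (hpd a b).submatrix (sortErrorS a b).injective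
  obtain ⟨η, γ, hη, hη', hγ, hηγ, hb, hAγ, hFγ⟩ :=
    exists_rates ((hpd' m m).posSemidef.diag2 PosSemidef.one) hN hAn hFn hstrict
  rw [sysNS_eq] at hb
  have hVu := isUnit_det_diag2 (hV.of_diag2.1).2.1
  have hWu := isUnit_det_diag2 (hW.of_diag2.1).2.1
  have hVu' := isUnit_det_diag2 hVu.2
  have hWu' := isUnit_det_diag2 hWu.2
  set EB : Matrix (Stack m) (Stack p) (RatFunc ℂ) := blockDiagonal' (extEnv11 S Sig) with hEB
  have hE : EB + ((par fun j => (env S Sigtil j).toBlocks₂₂) - EB) =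
      par fun j => (env S Sigtil j).toBlocks₂₂ := add_sub_cancel _ _
  have hP (j : Fin k) : InRHinf (permS S j) := hA.inter_stable.submatrix _ _
  have hL (j : Fin k) : InRHinf (extL S Sig j) := (hA.env_internallyStable j).2.1
  have hP22 (j : Fin k) : InRHinf (permS S j).toBlocks₂₂ := (hP j).submatrix Sum.inr Sum.inr
  have hP12 (j : Fin k) : InRHinf (permS S j).toBlocks₁₂.toRows₂ :=
    (hP j).submatrix (fun i => Sum.inl (Sum.inr i)) Sum.inr
  have hP21 (j : Fin k) : InRHinf (permS S j).toBlocks₂₁.toCols₂ :=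
    (hP j).submatrix Sum.inr (fun i => Sum.inl (Sum.inr i))
  have hP11 (j : Fin k) : InRHinf (permS S j).toBlocks₁₁.toBlocks₂₂ :=
    (hP j).submatrix (fun i => Sum.inl (Sum.inr i)) (fun i => Sum.inl (Sum.inr i))
  have hB (j : Fin k) : InRHinf (parBut Sig j) := InRHinf.parBut hA.sub_stable j
  refine interconnection_performance (Ebar := EB)
    (R := (par fun j => (env S Sigtil j).toBlocks₂₂) - EB)
    (A := blockDiagonal' (parBut fun l => Sigtil l - Sig l))
    (E12 := blockDiagonal' (extEnv12 S Sig)) (E21 := blockDiagonal' (extEnv21 S Sig))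
    (E22 := blockDiagonal' (extEnv22 S Sig)) (Sg := par Sig)
    (T := parLoop (fun j => (env S Sigtil j).toBlocks₂₂) Sig)
    (T' := parLoop (fun j => (env S Sigtil j).toBlocks₂₂) Sighat) hA.inter_stable hA.wellPosed
    hA.internallyStable ?_ ?_ ?_ ?_ (InRHinf.blockDiagonal' (InRHinf.parBut hAs)) ?_ ?_ ?_
    (extEnv_shift hA.env_wellPosed hwpt) rfl
    hV hW (hpd' m m) (hpd' p p).posSemidef hη hη' hηγ hb ?_
  · exact InRHinf.blockDiagonal' fun j =>
      (hP11 j).add ((((hP12 j).mul (hB j)).mul (hL j)).mul (hP21 j))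
  · exact InRHinf.blockDiagonal' fun j =>
      (hP12 j).mul (InRHinf.one.add (((hB j).mul (hL j)).mul (hP22 j)))
  · exact InRHinf.blockDiagonal' fun j => (hL j).mul (hP21 j)
  · exact InRHinf.blockDiagonal' fun j => (hL j).mul (hP22 j)
  · rw [← hF]
    exact InRHinf.par hFs
  · rw [hE, parLoop_sub hwp]
  · rw [hE, ← parLoop_eq hwp']
  · intro ω
    rw [← hF, inv_diag2 hWu.1 hWu.2, inv_diag2 hVu.1 hVu.2, inv_diag2 hWu'.1 hWu'.2,
      inv_diag2 hVu'.1 hVu'.2]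
    simp only [diag2_mul_diag2]
    rw [par, par, par, blockDiagonal'_weighted hWu.1 hVu.1,
      blockDiagonal'_weighted hWu'.1 hVu'.1]
    -- Each weight block is itself block diagonal over $l\ne j$, so the inverses are taken at two
    -- levels.
    have hwt (j : Fin k) : (parBut WA j)⁻¹ * parBut (fun l => Sigtil l - Sig l) j *
        (parBut VA j)⁻¹ = blockDiagonal' fun l : {l : Fin k // l ≠ j} =>
          weightedError (WA l) (VA l) (Sigtil l - Sig l) :=
      blockDiagonal'_weighted (isUnit_det_of_blockDiagonal' hWu.1 j)
        (isUnit_det_of_blockDiagonal' hVu.1 j) _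
    simp only [hwt, freqResp_diag2, freqResp_blockDiagonal']
    rw [diag2_eq_sortedError_S fun l => freqResp (weightedError (WA l) (VA l) (Sigtil l - Sig l)) ω]
    exact submatrix_scaled_posSemidef _ _ (errorScaling_sub_posSemidef hSc hd
      (fun j => matSpectralNorm_le_of_hinfNorm_le hγ (hAγ j) ω)
      (fun j => matSpectralNorm_le_of_hinfNorm_le hγ (hFγ j) ω))

end Subsystems

end

theorem theorem3 {k : ℕ} (m p : Fin k → ℕ) (mC pC : ℕ)
    (S : Matrix (Fin pC ⊕ Stack m) (Fin mC ⊕ Stack p) (RatFunc ℂ))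
    (Sig : ∀ j, Matrix (Fin (p j)) (Fin (m j)) (RatFunc ℂ))
    (hA : StandingAssumption S Sig)
    (VC : Matrix (Fin pC) (Fin pC) (RatFunc ℂ)) (WC : Matrix (Fin mC) (Fin mC) (RatFunc ℂ)) :
    -- environment abstraction
    (∀ (VE : ∀ j, Matrix (Fin (p j)) (Fin (p j)) (RatFunc ℂ))
       (WE : ∀ j, Matrix (Fin (m j)) (Fin (m j)) (RatFunc ℂ))
       (VF : ∀ j, Matrix (Fin (m j)) (Fin (m j)) (RatFunc ℂ))
       (WF : ∀ j, Matrix (Fin (p j)) (Fin (p j)) (RatFunc ℂ)),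
      IsBistableBiproper (weightE VE VF VC) → IsBistableBiproper (weightE WE WF WC) →
      ∀ D ∈ scalingsE m p mC pC,
      ScaledBound (weightE VE VF VC * sysNE S Sig * weightE WE WF WC) D 1 →
      ∀ (Ehat : ∀ j, Matrix (Fin pC ⊕ Fin (m j)) (Fin mC ⊕ Fin (p j)) (RatFunc ℂ))
        (Sighat : ∀ j, Matrix (Fin (p j)) (Fin (m j)) (RatFunc ℂ))
        (Gu : ∀ j, Matrix (Fin (m j)) (Fin (m j)) ℂ)
        (Gy : ∀ j, Matrix (Fin (p j)) (Fin (p j)) ℂ),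
      (∀ j, IsTransfer (Ehat j)) → (∀ j, IsTransfer (Sighat j)) →
      (∀ j, IsUnit (Gu j).det) → (∀ j, IsUnit (Gy j).det) →
      (∀ j, WellPosed (augEnv (Ehat j) (Gu j) (Gy j)) (Sig j)) →
      (∀ j, WellPosed (augEnv (Ehat j) (Gu j) (Gy j)) (Sighat j)) →
      (∀ j, InRHinf (Ehat j - env S Sig j).toBlocks₂₂) →
      (∀ j, InRHinf (redErrorNorm (Ehat j) (Gu j) (Gy j) (Sig j) (Sighat j))) →
      (∀ j, (Ehat j - env S Sig j).toBlocks₂₂ ∈ lowSpec (WE j) (VE j)) →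
      (∀ j, redErrorNorm (Ehat j) (Gu j) (Gy j) (Sig j) (Sighat j) ∈ lowSpec (WF j) (VF j)) →
      -- the scaled inequality and the low-level requirements are not both tight
      ((∃ η : ℝ, η < 1 ∧
          ScaledBound (weightE VE VF VC * sysNE S Sig * weightE WE WF WC) D η) ∨
        ((∀ j, hinfNorm (weightedError (WE j) (VE j) (Ehat j - env S Sig j).toBlocks₂₂) < 1) ∧
          ∀ j, hinfNorm (weightedError (WF j) (VF j)
            (redErrorNorm (Ehat j) (Gu j) (Gy j) (Sig j) (Sighat j))) < 1)) →
      WellPosed S (par Sighat) ∧ InternallyStable S (par Sighat) ∧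
        intError S Sig Sighat ∈ highSpec VC WC) ∧
    -- subsystem abstraction
    (∀ (VA : ∀ j, Matrix (Fin (m j)) (Fin (m j)) (RatFunc ℂ))
       (WA : ∀ j, Matrix (Fin (p j)) (Fin (p j)) (RatFunc ℂ))
       (VF : ∀ j, Matrix (Fin (m j)) (Fin (m j)) (RatFunc ℂ))
       (WF : ∀ j, Matrix (Fin (p j)) (Fin (p j)) (RatFunc ℂ)),
      IsBistableBiproper (weightS VA VF VC) → IsBistableBiproper (weightS WA WF WC) →
      ∀ D ∈ scalingsS m p mC pC,
      ScaledBound (weightS VA VF VC * sysNS S Sig * weightS WA WF WC) D 1 →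
      ∀ (Sigtil : ∀ j, Matrix (Fin (p j)) (Fin (m j)) (RatFunc ℂ))
        (Sighat : ∀ j, Matrix (Fin (p j)) (Fin (m j)) (RatFunc ℂ))
        (Gu : ∀ j, Matrix (Fin (m j)) (Fin (m j)) ℂ)
        (Gy : ∀ j, Matrix (Fin (p j)) (Fin (p j)) ℂ),
      (∀ j, IsTransfer (Sigtil j)) → (∀ j, IsTransfer (Sighat j)) →
      (∀ j, IsUnit (Gu j).det) → (∀ j, IsUnit (Gy j).det) →
      (∀ j, WellPosed (permS S j) (parBut Sigtil j)) →
      (∀ j, WellPosed (augEnv (env S Sigtil j) (Gu j) (Gy j)) (Sig j)) →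
      (∀ j, WellPosed (augEnv (env S Sigtil j) (Gu j) (Gy j)) (Sighat j)) →
      (∀ j, InRHinf (Sigtil j - Sig j)) →
      (∀ j, InRHinf (redErrorNorm (env S Sigtil j) (Gu j) (Gy j) (Sig j) (Sighat j))) →
      (∀ j, Sigtil j - Sig j ∈ lowSpec (WA j) (VA j)) →
      (∀ j, redErrorNorm (env S Sigtil j) (Gu j) (Gy j) (Sig j) (Sighat j) ∈
        lowSpec (WF j) (VF j)) →
      -- the scaled inequality and the low-level requirements are not both tight
      ((∃ η : ℝ, η < 1 ∧
          ScaledBound (weightS VA VF VC * sysNS S Sig * weightS WA WF WC) D η) ∨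
        ((∀ j, hinfNorm (weightedError (WA j) (VA j) (Sigtil j - Sig j)) < 1) ∧
          ∀ j, hinfNorm (weightedError (WF j) (VF j)
            (redErrorNorm (env S Sigtil j) (Gu j) (Gy j) (Sig j) (Sighat j))) < 1)) →
      WellPosed S (par Sighat) ∧ InternallyStable S (par Sighat) ∧
        intError S Sig Sighat ∈ highSpec VC WC) := by
  refine ⟨?_, ?_⟩
  · intro VE WE VF WF hV hW D hD hN Ehat Sighat Gu Gy _ _ hGu hGy hwp hwp' hAs hFs hAn hFn hst
    exact environment_abstraction_performance hA hV hW hD hN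
      (par_redErrorNorm Ehat hGu hGy Sig Sighat) (fun j => (hwp j).isUnit_augEnv)
      (fun j => (hwp' j).isUnit_augEnv) hAs hFs hAn hFn hst
  · intro VA WA VF WF hV hW D hD hN Sigtil Sighat Gu Gy _ _ hGu hGy hwpt hwp hwp' hAs hFs hAn hFn
      hst
    exact subsystem_abstraction_performance hA hV hW hD hN
      (par_redErrorNorm (env S Sigtil) hGu hGy Sig Sighat) hwpt (fun j => (hwp j).isUnit_augEnv)
      (fun j => (hwp' j).isUnit_augEnv) hAs hFs hAn hFn hst
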